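/- Let $N\ge 1$ and $C\ge 1$ be integers, and let $\vec C_N$ be the unidirectional cycle with vertices $0,\dots,N-1$ and arcs $(e,e+1)$ (indices modulo $N$). A request tournament $T_N$ consists of all arcs $(i,i+q)$ with $1\le q<N/2$ and, if $N$ is even, of exactly one of the two arcs $(i,i+N/2)$, $(i+N/2,i)$ for each $0\le i<N/2$. An arc $(i,j)$ of $T_N$ is routed along the dipath of $\vec C_N$ from $i$ to $j$; the load of a digraph $B\subseteq T_N$ on an arc $e$ of $\vec C_N$ is the number of arcs of $B$ whose dipath contains $e$. Let $A(C,N)$ be the minimum of $\sum_{\omega}|V(B_\omega)|$ over all request tournaments $T_N$ and all partitions of the arcs of $T_N$ into digraphs $B_\omega$ whose load on every arc of $\vec C_N$ is at most $C$. Then: - if $N\equiv 2\pmod{12}$, then $A(3,N)\le \frac{N^2}{4}+\frac{N+4}{6}$; - if $N\equiv 3\pmod{12}$, then $A(3,N)\le \frac{N^2+3}{4}$; - if $N\equiv 6\pmod{12}$, then $A(3,N)\le \frac{N^2}{4}+\frac{N}{6}$; - if $N\equiv 7\pmod{12}$, then $A(3,N)\le \frac{N^2-1}{4}$; - if $N\equiv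 10\pmod{12}$, then $A(3,N)\le \frac{N^2}{4}+\frac{N+8}{6}$; - if $N\equiv 11\pmod{12}$, then $A(3,N)\le \frac{N^2-1}{4}+\varepsilon$, where $\varepsilon=1$ for $N=11,35$ and $\varepsilon=0$ otherwise. These bounds are within a linear term in $N$ of the lower bounds $A(3,N)\ge\frac{N^2}{4}$, valid for all even $N$, and $A(3,N)\ge\frac{3N^2-N}{12}$, valid for all $N\equiv 3\pmod 4$. -/

import Mathlib

namespace RingGrooming

/-- Length of the dipath from `i` to `j` in the unidirectional cycle with vertices `0, …, N - 1`
and arcs `(e, e + 1)` taken modulo `N`. -/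
def ringDist {N : ℕ} (i j : Fin N) : ℕ := (j.val + N - i.val) % N

/-- The ring arc `(e, e + 1)`, named by its tail `e`, lies on the dipath that routes the
request `r`. -/
def Uses {N : ℕ} (r : Fin N × Fin N) (e : Fin N) : Prop :=
  ringDist r.1 e < ringDist r.1 r.2

instance {N : ℕ} (r : Fin N × Fin N) (e : Fin N) : Decidable (Uses r e) :=
  inferInstanceAs (Decidable (_ < _))

/-- The load that the set of requests `B` puts on the ring arc `(e, e + 1)`. -/
def load {N : ℕ} (B : Finset (Fin N × Fin N)) (e : Fin N) : ℕ :=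
  (B.filter fun r => Uses r e).card

/-- The vertices of the digraph with arc set `B`. -/
def nodes {N : ℕ} (B : Finset (Fin N × Fin N)) : Finset (Fin N) :=
  B.image Prod.fst ∪ B.image Prod.snd

/-- `T` is the arc set of a tournament of clockwise requests for symmetric shortest path routing:
it consists of all arcs `(i, i + q)` with `1 ≤ q < N / 2` and, if `N` is even, of exactly one of
the arcs `(i, i + N / 2)` and `(i + N / 2, i)` for each antipodal pair. -/
structure IsRequestTournament {N : ℕ} (T : Finset (Fin N × Fin N)) : Prop where
  /-- All arcs of the tournament are nontrivial shortest paths. -/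
  dist_le : ∀ i j, (i, j) ∈ T → i ≠ j ∧ 2 * ringDist i j ≤ N
  /-- All arcs shorter than half the ring are present. -/
  mem_of_lt : ∀ i j, i ≠ j → 2 * ringDist i j < N → (i, j) ∈ T
  /-- For each antipodal pair exactly one orientation is present. -/
  antipodal : ∀ i j, 2 * ringDist i j = N → Xor ((i, j) ∈ T) ((j, i) ∈ T)

/-- `A` is the number of ADMs of some valid solution for grooming factor `C` on the ring with `N`
nodes: some partition of a request tournament into subdigraphs, each of which loads each ring arc
at most `C` times, has `A` vertices in total. -/
def IsCost (C N A : ℕ) : Prop :=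
  ∃ T : Finset (Fin N × Fin N), IsRequestTournament T ∧
    ∃ P : Finpartition T, (∀ B ∈ P.parts, ∀ e, load B e ≤ C) ∧
      ∑ B ∈ P.parts, (nodes B).card = A

/-- The minimum total number of vertices `A(C, N)` of a valid solution. -/
noncomputable def adm (C N : ℕ) : ℕ := sInf {A | IsCost C N A}

lemma ringDist_swap {N : ℕ} (i j : Fin N) (h : i ≠ j) : ringDist i j + ringDist j i = N := by
  have hi := i.isLt
  have hj := j.isLt
  have hne : i.val ≠ j.val := fun h' => h (Fin.ext h')
  unfold ringDist
  rcases Nat.lt_or_gt_of_ne hne with h1 | h1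
  · rw [show j.val + N - i.val = (j.val - i.val) + N by omega, Nat.add_mod_right,
      Nat.mod_eq_of_lt (show j.val - i.val < N by omega),
      Nat.mod_eq_of_lt (show i.val + N - j.val < N by omega)]
    omega
  · rw [show i.val + N - j.val = (i.val - j.val) + N by omega, Nat.add_mod_right,
      Nat.mod_eq_of_lt (show i.val - j.val < N by omega),
      Nat.mod_eq_of_lt (show j.val + N - i.val < N by omega)]
    omega

/-- For every positive grooming factor a valid solution exists, so the minimum defining `adm C N`
is attained. -/
lemma isCost_adm (C N : ℕ) (hC : 1 ≤ C) : IsCost C N (adm C N) := by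
  apply Nat.sInf_mem (s := {A | IsCost C N A})
  let T : Finset (Fin N × Fin N) := Finset.univ.filter fun r =>
    r.1 ≠ r.2 ∧ (2 * ringDist r.1 r.2 < N ∨ (2 * ringDist r.1 r.2 = N ∧ r.1 < r.2))
  have hT : ∀ i j, (i, j) ∈ T ↔
      i ≠ j ∧ (2 * ringDist i j < N ∨ (2 * ringDist i j = N ∧ i < j)) := by
    intro i j
    simp [T]
  refine ⟨_, T, ⟨?_, ?_, ?_⟩, ⊥, ?_, rfl⟩
  · intro i j h
    obtain ⟨h1, h2⟩ := (hT i j).1 h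
    exact ⟨h1, by omega⟩
  · intro i j h1 h2
    exact (hT i j).2 ⟨h1, Or.inl h2⟩
  · intro i j h
    have hne : i ≠ j := by
      rintro rfl
      have h0 : ringDist i i = 0 := by simp [ringDist]
      have := i.isLt
      omega
    have hs := ringDist_swap i j hne
    have hs' : 2 * ringDist j i = N := by omega
    rcases lt_or_gt_of_ne hne with hlt | hlt
    · refine Or.inl ⟨(hT i j).2 ⟨hne, Or.inr ⟨h, hlt⟩⟩, fun hji => ?_⟩
      obtain ⟨-, h2 | h2⟩ := (hT j i).1 hji
      · omega
      · exact absurd h2.2 (not_lt.2 hlt.le)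
    · refine Or.inr ⟨(hT j i).2 ⟨hne.symm, Or.inr ⟨hs', hlt⟩⟩, fun hij => ?_⟩
      obtain ⟨-, h2 | h2⟩ := (hT i j).1 hij
      · omega
      · exact absurd h2.2 (not_lt.2 hlt.le)
  · intro B hB e
    rw [Finpartition.mem_bot_iff] at hB
    obtain ⟨r, -, rfl⟩ := hB
    exact le_trans (Finset.card_filter_le _ _) (by simpa using hC)

end RingGrooming

/-! Both directions rest on the fact that a subgraph of load at most three has average degree at
most four. Lower bounds: three arcs leaving (or entering) `v` saturate the ring arc at `v`, which
forces the next (or previous) vertex of the subgraph to have degree at most two. Distinct saturated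
sides point to distinct such vertices (`card_three_le_card_low`), so degrees five and six are paid
for. Applying this to a subadditive weight of the degree, instead of the degree itself, also
exploits the residue of the total degree N - 1 modulo 2 or 4 (`weight_le_adm`). Upper bounds: write
N = 2n + δ with δ ≤ 1 and let a point a < n stand for the vertices a and a + n. Two points a < b
give the circuit a, b, a + n, b + n, which winds once around the ring and so has load one. The three
circuits of a triple of points therefore form a subgraph of load three with twelve arcs on six
vertices, of degree four everywhere. A triple system on the points thus handles all arcs except the
n arcs a → a + n, completed through the vertex 2n if δ = 1. These are merged with some of the
triples: a gadget is a small set of triples and pairs regrouped by an explicit, kernel-checked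
cover, and `adm_le_of_design` allows point-disjoint gadgets inside any triple system. It remains to
find triple systems whose points are partitioned by suitable gadgets: the Bose system for n ≡ 3 mod
6, with disjoint columns; a Skolem system for n ≡ 1 mod 6, with a well-chosen quasigroup; and, for n
≡ 5 mod 6, a system with a hole of five points, in which the hole and three triples form one special
gadget, the sun, while disjoint triples cover the remaining points. -/

namespace RingGrooming

open Finset

/-! ### Arcs and dipaths on the ring in coordinates -/

lemma ringDist_of_le {N : ℕ} {i j : Fin N} (h : i.val ≤ j.val) :
    ringDist i j = j.val - i.val := by
  have := j.isLt
  unfold ringDist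
  rw [show j.val + N - i.val = (j.val - i.val) + N by omega, Nat.add_mod_right,
    Nat.mod_eq_of_lt (by omega)]

lemma ringDist_of_lt {N : ℕ} {i j : Fin N} (h : j.val < i.val) :
    ringDist i j = j.val + N - i.val := by
  have := i.isLt
  unfold ringDist
  rw [Nat.mod_eq_of_lt (by omega)]

lemma ringDist_cases {N : ℕ} (i j : Fin N) :
    (i.val ≤ j.val ∧ ringDist i j = j.val - i.val) ∨
      (j.val < i.val ∧ ringDist i j = j.val + N - i.val) := by
  rcases le_or_gt i.val j.val with h | h
  · exact Or.inl ⟨h, ringDist_of_le h⟩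
  · exact Or.inr ⟨h, ringDist_of_lt h⟩

/-- The dipath from `i` to `j` contains the ring arc with tail `e`, spelled out. -/
lemma uses_iff {N : ℕ} {i j e : Fin N} :
    Uses (i, j) e ↔ (i.val ≤ e.val ∧ e.val < j.val) ∨
      (j.val < i.val ∧ (i.val ≤ e.val ∨ e.val < j.val)) := by
  have := i.isLt
  have := j.isLt
  have := e.isLt
  unfold Uses
  rcases ringDist_cases i j with ⟨h1, h2⟩ | ⟨h1, h2⟩ <;>
    rcases ringDist_cases i e with ⟨h3, h4⟩ | ⟨h3, h4⟩ <;> simp only [h2, h4] <;> omega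

/-- The predecessor of a ring vertex. -/
def prior {N : ℕ} (v : Fin N) : Fin N :=
  ⟨if v.val = 0 then N - 1 else v.val - 1, by have := v.isLt; split_ifs <;> omega⟩

lemma prior_val {N : ℕ} (v : Fin N) :
    (v.val = 0 ∧ (prior v).val = N - 1) ∨ (0 < v.val ∧ (prior v).val = v.val - 1) := by
  unfold prior
  split_ifs with h
  · exact Or.inl ⟨h, rfl⟩
  · exact Or.inr ⟨by omega, rfl⟩

/-- The arcs of `B` leaving `v`. -/
def outs {N : ℕ} (B : Finset (Fin N × Fin N)) (v : Fin N) : Finset (Fin N × Fin N) :=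
  B.filter fun r => r.1 = v

/-- The arcs of `B` entering `v`. -/
def ins {N : ℕ} (B : Finset (Fin N × Fin N)) (v : Fin N) : Finset (Fin N × Fin N) :=
  B.filter fun r => r.2 = v

lemma mem_nodes {N : ℕ} {B : Finset (Fin N × Fin N)} {v : Fin N} :
    v ∈ nodes B ↔ (∃ w, (v, w) ∈ B) ∨ ∃ w, (w, v) ∈ B := by
  simp [nodes]

/-! ### Lower bounds: degrees inside one subgraph of load at most three -/

section Subgraph

variable {N : ℕ} {B : Finset (Fin N × Fin N)}

lemma card_le_three_of_uses (hB : ∀ e, load B e ≤ 3) {S : Finset (Fin N × Fin N)} (e : Fin N)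
    (hS : ∀ r ∈ S, r ∈ B ∧ Uses r e) : S.card ≤ 3 :=
  (card_le_card fun r hr => mem_filter.2 (hS r hr)).trans (hB e)

lemma uses_fst (r : Fin N × Fin N) (h : r.1 ≠ r.2) : Uses r r.1 := by
  obtain ⟨i, j⟩ := r
  have h' : i.val ≠ j.val := fun h'' => h (Fin.ext h'')
  exact uses_iff.2 (by dsimp only; omega)

lemma uses_prior_snd (r : Fin N × Fin N) (h : r.1 ≠ r.2) : Uses r (prior r.2) := by
  obtain ⟨i, j⟩ := r
  have h' : i.val ≠ j.val := fun h'' => h (Fin.ext h'')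
  have := i.isLt
  have := j.isLt
  have := prior_val j
  exact uses_iff.2 (by dsimp only; omega)

lemma outs_card_le (hB : ∀ e, load B e ≤ 3) (hne : ∀ r ∈ B, r.1 ≠ r.2) (v : Fin N) :
    (outs B v).card ≤ 3 := by
  refine card_le_three_of_uses hB v fun r hr => ?_
  obtain ⟨hr', rfl⟩ := mem_filter.1 hr
  exact ⟨hr', uses_fst r (hne r hr')⟩

lemma ins_card_le (hB : ∀ e, load B e ≤ 3) (hne : ∀ r ∈ B, r.1 ≠ r.2) (v : Fin N) :
    (ins B v).card ≤ 3 := by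
  refine card_le_three_of_uses hB (prior v) fun r hr => ?_
  obtain ⟨hr', rfl⟩ := mem_filter.1 hr
  exact ⟨hr', uses_prior_snd r (hne r hr')⟩

/-- If three arcs of `B` leave `v`, no other arc of `B` uses the ring arc leaving `v`. -/
lemma fst_eq_of_uses (hB : ∀ e, load B e ≤ 3) (hne : ∀ r ∈ B, r.1 ≠ r.2) {v : Fin N}
    (hv : (outs B v).card = 3) {r : Fin N × Fin N} (hr : r ∈ B) (hu : Uses r v) : r.1 = v := by
  by_contra h
  have hr' : r ∉ outs B v := fun h' => h (mem_filter.1 h').2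
  have := card_le_three_of_uses hB (S := insert r (outs B v)) v (by
    intro s hs
    rcases mem_insert.1 hs with rfl | hs
    · exact ⟨hr, hu⟩
    · obtain ⟨hs', rfl⟩ := mem_filter.1 hs
      exact ⟨hs', uses_fst s (hne s hs')⟩)
  rw [card_insert_of_notMem hr'] at this
  omega

/-- If three arcs of `B` enter `v`, no other arc of `B` uses the ring arc entering `v`. -/
lemma snd_eq_of_uses (hB : ∀ e, load B e ≤ 3) (hne : ∀ r ∈ B, r.1 ≠ r.2) {v : Fin N}
    (hv : (ins B v).card = 3) {r : Fin N × Fin N} (hr : r ∈ B) (hu : Uses r (prior v)) :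
    r.2 = v := by
  by_contra h
  have hr' : r ∉ ins B v := fun h' => h (mem_filter.1 h').2
  have := card_le_three_of_uses hB (S := insert r (ins B v)) (prior v) (by
    intro s hs
    rcases mem_insert.1 hs with rfl | hs
    · exact ⟨hr, hu⟩
    · obtain ⟨hs', rfl⟩ := mem_filter.1 hs
      exact ⟨hs', uses_prior_snd s (hne s hs')⟩)
  rw [card_insert_of_notMem hr'] at this
  omega

/-- `w` is the vertex of `B` that follows `v` in the cyclic order. -/
def IsNext (B : Finset (Fin N × Fin N)) (v w : Fin N) : Prop :=
  w ∈ nodes B ∧ w ≠ v ∧ ∀ u ∈ nodes B, u ≠ v → ringDist v w ≤ ringDist v u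

/-- `w` is the vertex of `B` that precedes `v` in the cyclic order. -/
def IsPrev (B : Finset (Fin N × Fin N)) (v w : Fin N) : Prop :=
  w ∈ nodes B ∧ w ≠ v ∧ ∀ u ∈ nodes B, u ≠ v → ringDist w v ≤ ringDist u v

lemma exists_isNext {v u : Fin N} (hu : u ∈ nodes B) (huv : u ≠ v) : ∃ w, IsNext B v w := by
  obtain ⟨w, hw, hmin⟩ := exists_min_image ((nodes B).erase v) (fun u => ringDist v u)
    ⟨u, mem_erase.2 ⟨huv, hu⟩⟩
  exact ⟨w, mem_of_mem_erase hw, ne_of_mem_erase hw, fun x hx hxv =>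
    hmin x (mem_erase.2 ⟨hxv, hx⟩)⟩

lemma exists_isPrev {v u : Fin N} (hu : u ∈ nodes B) (huv : u ≠ v) : ∃ w, IsPrev B v w := by
  obtain ⟨w, hw, hmin⟩ := exists_min_image ((nodes B).erase v) (fun u => ringDist u v)
    ⟨u, mem_erase.2 ⟨huv, hu⟩⟩
  exact ⟨w, mem_of_mem_erase hw, ne_of_mem_erase hw, fun x hx hxv =>
    hmin x (mem_erase.2 ⟨hxv, hx⟩)⟩

lemma fst_mem_nodes {r : Fin N × Fin N} (hr : r ∈ B) : r.1 ∈ nodes B :=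
  mem_nodes.2 (Or.inl ⟨r.2, hr⟩)

lemma snd_mem_nodes {r : Fin N × Fin N} (hr : r ∈ B) : r.2 ∈ nodes B :=
  mem_nodes.2 (Or.inr ⟨r.1, hr⟩)

/-- The arcs out of `v` fill the ring arc at `v`, so an arc entering `w` can only come from `v`. The
arcs from `v` that do not stop at `w` run on past `w` and share the ring arc there with the arcs
leaving `w`. Hence the out-degree of `w` is at most its in-degree, which is at most one. -/
lemma degree_next_le (hB : ∀ e, load B e ≤ 3) (hne : ∀ r ∈ B, r.1 ≠ r.2) {v w : Fin N}
    (hv : (outs B v).card = 3) (hw : IsNext B v w) :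
    (outs B w).card + (ins B w).card ≤ 2 := by
  obtain ⟨-, hwv, hmin⟩ := hw
  have hwv' : w.val ≠ v.val := fun h => hwv (Fin.ext h)
  have hin : ins B w ⊆ {(v, w)} := by
    intro r hr
    obtain ⟨hr, hrw⟩ := mem_filter.1 hr
    have h1 : r.1 = v := by
      by_contra h1
      have hd := hmin r.1 (fst_mem_nodes hr) h1
      have hne' := hne r hr
      refine h1 (fst_eq_of_uses hB hne hv hr ?_)
      obtain ⟨a, b⟩ := r
      dsimp only at *
      subst hrw
      have h1' : a.val ≠ v.val := fun h => h1 (Fin.ext h)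
      have h2' : a.val ≠ b.val := fun h => hne' (Fin.ext h)
      have := a.isLt
      have := b.isLt
      have := v.isLt
      rw [uses_iff]
      rcases ringDist_cases v b with h3 | h3 <;> rcases ringDist_cases v a with h4 | h4 <;> omega
    exact mem_singleton.2 (Prod.ext h1 hrw)
  have hun := card_le_three_of_uses hB (S := outs B w ∪ (outs B v).filter fun r => r.2 ≠ w) w (by
    intro r hr
    rcases mem_union.1 hr with hr | hr
    · obtain ⟨hr', rfl⟩ := mem_filter.1 hr
      exact ⟨hr', uses_fst r (hne r hr')⟩
    · obtain ⟨hr, hrw⟩ := mem_filter.1 hr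
      obtain ⟨hr, hrv⟩ := mem_filter.1 hr
      refine ⟨hr, ?_⟩
      have hne' := hne r hr
      have hd := hmin r.2 (snd_mem_nodes hr) (fun h => hne' (hrv.trans h.symm))
      obtain ⟨a, b⟩ := r
      dsimp only at *
      subst hrv
      have h1' : b.val ≠ w.val := fun h => hrw (Fin.ext h)
      have h2' : a.val ≠ b.val := fun h => hne' (Fin.ext h)
      have := a.isLt
      have := b.isLt
      have := w.isLt
      rw [uses_iff]
      rcases ringDist_cases a b with h3 | h3 <;> rcases ringDist_cases a w with h4 | h4 <;> omega)
  have hdisj : Disjoint (outs B w) ((outs B v).filter fun r => r.2 ≠ w) := by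
    rw [disjoint_left]
    intro r h1 h2
    exact hwv ((mem_filter.1 h1).2.symm.trans (mem_filter.1 (mem_filter.1 h2).1).2)
  rw [card_union_of_disjoint hdisj] at hun
  have hsplit := card_filter_add_card_filter_not (s := outs B v) (fun r => r.2 ≠ w)
  have hsub : ((outs B v).filter fun r => ¬ r.2 ≠ w) ⊆ ins B w := by
    intro r hr
    obtain ⟨hr, hrw⟩ := mem_filter.1 hr
    exact mem_filter.2 ⟨(mem_filter.1 hr).1, not_not.1 hrw⟩
  have h1 := card_le_card hsub
  have h2 := card_le_card hin
  rw [card_singleton] at h2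
  by_cases hvw : (v, w) ∈ B
  · omega
  · have : ins B w = ∅ := by
      rw [eq_empty_iff_forall_notMem]
      intro r hr
      have := mem_singleton.1 (hin hr)
      exact hvw (this ▸ (mem_filter.1 hr).1)
    rw [this, card_empty] at *
    omega

/-- Mirror image of `degree_next_le`: arcs entering `v` saturate the ring arc before `v`. -/
lemma degree_prev_le (hB : ∀ e, load B e ≤ 3) (hne : ∀ r ∈ B, r.1 ≠ r.2) {v w : Fin N}
    (hv : (ins B v).card = 3) (hw : IsPrev B v w) :
    (outs B w).card + (ins B w).card ≤ 2 := by
  obtain ⟨-, hwv, hmin⟩ := hw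
  have hwv' : w.val ≠ v.val := fun h => hwv (Fin.ext h)
  have hout : outs B w ⊆ {(w, v)} := by
    intro r hr
    obtain ⟨hr, hrw⟩ := mem_filter.1 hr
    have h1 : r.2 = v := by
      by_contra h1
      have hd := hmin r.2 (snd_mem_nodes hr) h1
      have hne' := hne r hr
      refine h1 (snd_eq_of_uses hB hne hv hr ?_)
      obtain ⟨b, a⟩ := r
      dsimp only at *
      subst hrw
      have h1' : a.val ≠ v.val := fun h => h1 (Fin.ext h)
      have h2' : a.val ≠ b.val := fun h => hne' (Fin.ext h).symm
      have := a.isLt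
      have := b.isLt
      have := v.isLt
      have := prior_val v
      rw [uses_iff]
      rcases ringDist_cases b v with h3 | h3 <;> rcases ringDist_cases a v with h4 | h4 <;> omega
    exact mem_singleton.2 (Prod.ext hrw h1)
  have hun := card_le_three_of_uses hB (S := ins B w ∪ (ins B v).filter fun r => r.1 ≠ w)
    (prior w) (by
    intro r hr
    rcases mem_union.1 hr with hr | hr
    · obtain ⟨hr', rfl⟩ := mem_filter.1 hr
      exact ⟨hr', uses_prior_snd r (hne r hr')⟩
    · obtain ⟨hr, hrw⟩ := mem_filter.1 hr
      obtain ⟨hr, hrv⟩ := mem_filter.1 hr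
      refine ⟨hr, ?_⟩
      have hne' := hne r hr
      have hd := hmin r.1 (fst_mem_nodes hr) (fun h => hne' (h.trans hrv.symm))
      obtain ⟨b, a⟩ := r
      dsimp only at *
      subst hrv
      have h1' : b.val ≠ w.val := fun h => hrw (Fin.ext h)
      have h2' : a.val ≠ b.val := fun h => hne' (Fin.ext h).symm
      have := a.isLt
      have := b.isLt
      have := w.isLt
      have := prior_val w
      rw [uses_iff]
      rcases ringDist_cases b a with h3 | h3 <;> rcases ringDist_cases w a with h4 | h4 <;> omega)
  have hdisj : Disjoint (ins B w) ((ins B v).filter fun r => r.1 ≠ w) := by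
    rw [disjoint_left]
    intro r h1 h2
    exact hwv ((mem_filter.1 h1).2.symm.trans (mem_filter.1 (mem_filter.1 h2).1).2)
  rw [card_union_of_disjoint hdisj] at hun
  have hsplit := card_filter_add_card_filter_not (s := ins B v) (fun r => r.1 ≠ w)
  have hsub : ((ins B v).filter fun r => ¬ r.1 ≠ w) ⊆ outs B w := by
    intro r hr
    obtain ⟨hr, hrw⟩ := mem_filter.1 hr
    exact mem_filter.2 ⟨(mem_filter.1 hr).1, not_not.1 hrw⟩
  have h1 := card_le_card hsub
  have h2 := card_le_card hout
  rw [card_singleton] at h2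
  by_cases hvw : (w, v) ∈ B
  · omega
  · have : outs B w = ∅ := by
      rw [eq_empty_iff_forall_notMem]
      intro r hr
      have := mem_singleton.1 (hout hr)
      exact hvw (this ▸ (mem_filter.1 hr).1)
    rw [this, card_empty] at *
    omega

lemma IsNext.injective {v v' w : Fin N} (hv : v ∈ nodes B) (hv' : v' ∈ nodes B)
    (h : IsNext B v w) (h' : IsNext B v' w) : v = v' := by
  by_contra hne
  have h1 := h.2.2 v' hv' (Ne.symm hne)
  have h2 := h'.2.2 v hv hne
  have h3 : w.val ≠ v.val := fun h' => h.2.1 (Fin.ext h')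
  have h4 : w.val ≠ v'.val := fun h => h'.2.1 (Fin.ext h)
  have h5 : v.val ≠ v'.val := fun h => hne (Fin.ext h)
  have := v.isLt
  have := v'.isLt
  have := w.isLt
  rcases ringDist_cases v w with h6 | h6 <;> rcases ringDist_cases v' w with h7 | h7 <;>
    rcases ringDist_cases v v' with h8 | h8 <;> rcases ringDist_cases v' v with h9 | h9 <;> omega

lemma IsPrev.injective {v v' w : Fin N} (hv : v ∈ nodes B) (hv' : v' ∈ nodes B)
    (h : IsPrev B v w) (h' : IsPrev B v' w) : v = v' := by
  by_contra hne
  have h1 := h.2.2 v' hv' (Ne.symm hne)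
  have h2 := h'.2.2 v hv hne
  have h3 : w.val ≠ v.val := fun h' => h.2.1 (Fin.ext h')
  have h4 : w.val ≠ v'.val := fun h => h'.2.1 (Fin.ext h)
  have h5 : v.val ≠ v'.val := fun h => hne (Fin.ext h)
  have := v.isLt
  have := v'.isLt
  have := w.isLt
  rcases ringDist_cases w v with h6 | h6 <;> rcases ringDist_cases w v' with h7 | h7 <;>
    rcases ringDist_cases v v' with h8 | h8 <;> rcases ringDist_cases v' v with h9 | h9 <;> omega

/-- Between `v` and `v'` there is only `w`. An arc from `v` ending neither at `w` nor at `v'` would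
use the ring arc entering `v'`, which is saturated by arcs ending there; so at most two arcs could
leave `v`. -/
lemma not_isNext_and_isPrev (hB : ∀ e, load B e ≤ 3) (hne : ∀ r ∈ B, r.1 ≠ r.2) {v v' w : Fin N}
    (hv : (outs B v).card = 3) (hv' : (ins B v').card = 3) (h : IsNext B v w)
    (h' : IsPrev B v' w) : False := by
  have hsub : outs B v ⊆ {(v, w), (v, v')} := by
    intro r hr
    obtain ⟨hr, hrv⟩ := mem_filter.1 hr
    have hne' := hne r hr
    suffices r.2 = w ∨ r.2 = v' by
      rcases this with h2 | h2
      · exact mem_insert.2 (Or.inl (Prod.ext hrv h2))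
      · exact mem_insert.2 (Or.inr (mem_singleton.2 (Prod.ext hrv h2)))
    by_contra! hcon
    obtain ⟨hc1, hc2⟩ := hcon
    refine hc2 (snd_eq_of_uses hB hne hv' hr ?_)
    have hd1 := h.2.2 r.2 (snd_mem_nodes hr) (fun h' => hne' (hrv.trans h'.symm))
    have hd2 := h'.2.2 r.2 (snd_mem_nodes hr) hc2
    obtain ⟨a, b⟩ := r
    dsimp only at *
    subst hrv
    have e1 : b.val ≠ w.val := fun h => hc1 (Fin.ext h)
    have e2 : b.val ≠ v'.val := fun h => hc2 (Fin.ext h)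
    have e3 : a.val ≠ b.val := fun h => hne' (Fin.ext h)
    have e4 : w.val ≠ a.val := fun h' => h.2.1 (Fin.ext h')
    have e5 : w.val ≠ v'.val := fun h => h'.2.1 (Fin.ext h)
    have := a.isLt
    have := b.isLt
    have := w.isLt
    have := v'.isLt
    have := prior_val v'
    rw [uses_iff]
    rcases ringDist_cases a w with h6 | h6 <;> rcases ringDist_cases w v' with h7 | h7 <;>
      rcases ringDist_cases a b with h8 | h8 <;> rcases ringDist_cases b v' with h9 | h9 <;> omega
  have := (card_le_card hsub).trans card_le_two
  omega

/-- The vertices of out-degree three and those of in-degree three are together at most as many as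
the vertices of degree at most two. -/
lemma card_three_le_card_low (hB : ∀ e, load B e ≤ 3) (hne : ∀ r ∈ B, r.1 ≠ r.2) :
    ((nodes B).filter fun v => (outs B v).card = 3).card +
      ((nodes B).filter fun v => (ins B v).card = 3).card ≤
    ((nodes B).filter fun v => (outs B v).card + (ins B v).card ≤ 2).card := by
  classical
  have hex1 : ∀ v, (outs B v).card = 3 → ∃ w, IsNext B v w := by
    intro v hv
    obtain ⟨r, hr⟩ : (outs B v).Nonempty := card_pos.1 (by omega)
    obtain ⟨hr, hrv⟩ := mem_filter.1 hr
    exact exists_isNext (snd_mem_nodes hr) fun h => hne r hr (hrv.trans h.symm)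
  have hex2 : ∀ v, (ins B v).card = 3 → ∃ w, IsPrev B v w := by
    intro v hv
    obtain ⟨r, hr⟩ : (ins B v).Nonempty := card_pos.1 (by omega)
    obtain ⟨hr, hrv⟩ := mem_filter.1 hr
    exact exists_isPrev (fst_mem_nodes hr) fun h => hne r hr (h.trans hrv.symm)
  choose! f hf using hex1
  choose! g hg using hex2
  rw [← card_image_of_injOn (s := (nodes B).filter fun v => (outs B v).card = 3) (f := f),
    ← card_image_of_injOn (s := (nodes B).filter fun v => (ins B v).card = 3) (f := g),
    ← card_union_of_disjoint]
  · refine card_le_card fun w hw => ?_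
    rcases mem_union.1 hw with hw | hw <;> obtain ⟨v, hv, rfl⟩ := mem_image.1 hw <;>
      obtain ⟨-, hv⟩ := mem_filter.1 hv
    · exact mem_filter.2 ⟨(hf v hv).1, degree_next_le hB hne hv (hf v hv)⟩
    · exact mem_filter.2 ⟨(hg v hv).1, degree_prev_le hB hne hv (hg v hv)⟩
  · rw [disjoint_left]
    intro w h1 h2
    obtain ⟨v, hv, rfl⟩ := mem_image.1 h1
    obtain ⟨v', hv', h⟩ := mem_image.1 h2
    obtain ⟨-, hv⟩ := mem_filter.1 hv
    obtain ⟨-, hv'⟩ := mem_filter.1 hv'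
    exact not_isNext_and_isPrev hB hne hv hv' (hf v hv) (h ▸ hg v' hv')
  · intro v hv v' hv' h
    obtain ⟨h1, hv⟩ := mem_filter.1 hv
    obtain ⟨h1', hv'⟩ := mem_filter.1 hv'
    have hgv := hg v hv
    rw [h] at hgv
    exact hgv.injective h1 h1' (hg v' hv')
  · intro v hv v' hv' h
    obtain ⟨h1, hv⟩ := mem_filter.1 hv
    obtain ⟨h1', hv'⟩ := mem_filter.1 hv'
    have hfv := hf v hv
    rw [h] at hfv
    exact hfv.injective h1 h1' (hf v' hv')

/-- The degree of `v` in `B`. -/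
def degree (B : Finset (Fin N × Fin N)) (v : Fin N) : ℕ := (outs B v).card + (ins B v).card

lemma degree_pos {v : Fin N} (hv : v ∈ nodes B) : 1 ≤ degree B v := by
  rcases mem_nodes.1 hv with ⟨w, hw⟩ | ⟨w, hw⟩
  · have : 0 < (outs B v).card := card_pos.2 ⟨_, mem_filter.2 ⟨hw, rfl⟩⟩
    unfold degree; omega
  · have : 0 < (ins B v).card := card_pos.2 ⟨_, mem_filter.2 ⟨hw, rfl⟩⟩
    unfold degree; omega

lemma degree_eq_zero {v : Fin N} (hv : v ∉ nodes B) : degree B v = 0 := by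
  rw [mem_nodes, not_or] at hv
  have h1 : outs B v = ∅ := filter_eq_empty_iff.2 fun r hr h => hv.1 ⟨r.2, h ▸ hr⟩
  have h2 : ins B v = ∅ := filter_eq_empty_iff.2 fun r hr h => hv.2 ⟨r.1, h ▸ hr⟩
  simp [degree, h1, h2]

/-- A weight of degrees whose excess over `4 * c` is paid for by vertices of degree at most two has
sum at most `4 * c` per vertex of `B`. -/
lemma sum_weight_le (hB : ∀ e, load B e ≤ 3) (hne : ∀ r ∈ B, r.1 ≠ r.2) (g : ℕ → ℕ) (c a : ℕ)
    (h0 : g 0 = 0)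
    (hg : ∀ o i, o ≤ 3 → i ≤ 3 → 1 ≤ o + i → g (o + i) + (if o + i ≤ 2 then a else 0) ≤
      c + ((if o = 3 then a else 0) + (if i = 3 then a else 0))) :
    ∑ v, g (degree B v) ≤ c * (nodes B).card := by
  have hsum : ∑ v, g (degree B v) = ∑ v ∈ nodes B, g (degree B v) := by
    symm
    refine sum_subset (subset_univ _) fun v _ hv => ?_
    rw [degree_eq_zero hv, h0]
  have h1 := sum_le_sum fun v (hv : v ∈ nodes B) =>
    hg (outs B v).card (ins B v).card (outs_card_le hB hne v) (ins_card_le hB hne v)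
      (degree_pos hv)
  simp only [sum_add_distrib, ← sum_filter, sum_const, smul_eq_mul] at h1
  -- Each saturated side may overdraw the budget `c` by `a`, and each vertex of degree at most two
  -- leaves `a` unspent. There are at least as many of the latter, so the corrections cancel in the
  -- sum.
  have h2 := Nat.mul_le_mul_right a (card_three_le_card_low hB hne)
  rw [hsum]
  unfold degree
  nlinarith

end Subgraph

/-! ### Lower bounds: summing weights of degrees over a partition -/

lemma degree_tournament {N : ℕ} {T : Finset (Fin N × Fin N)} (hT : IsRequestTournament T)
    (v : Fin N) : degree T v = N - 1 := by
  have h1 : (outs T v).card = (univ.filter fun u => (v, u) ∈ T).card :=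
    card_bij' (fun r _ => r.2) (fun u _ => (v, u))
      (by rintro ⟨a, b⟩ h; obtain ⟨h', rfl⟩ := mem_filter.1 h; simpa using h')
      (by intro u h; simpa [outs] using h)
      (by rintro ⟨a, b⟩ h; obtain ⟨h, rfl⟩ := mem_filter.1 h; rfl)
      (by intro u h; rfl)
  have h2 : (ins T v).card = (univ.filter fun u => (u, v) ∈ T).card :=
    card_bij' (fun r _ => r.1) (fun u _ => (u, v))
      (by rintro ⟨a, b⟩ h; obtain ⟨h', rfl⟩ := mem_filter.1 h; simpa using h')
      (by intro u h; simpa [ins] using h)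
      (by rintro ⟨a, b⟩ h; obtain ⟨h, rfl⟩ := mem_filter.1 h; rfl)
      (by intro u h; rfl)
  have key : ∀ u, u ≠ v → Xor ((v, u) ∈ T) ((u, v) ∈ T) := by
    intro u huv
    have hs := ringDist_swap v u huv.symm
    rcases lt_trichotomy (2 * ringDist v u) N with h | h | h
    · refine Or.inl ⟨hT.mem_of_lt v u huv.symm h, fun h' => ?_⟩
      have := (hT.dist_le _ _ h').2
      omega
    · exact hT.antipodal v u h
    · refine Or.inr ⟨hT.mem_of_lt u v huv (by omega), fun h' => ?_⟩
      have := (hT.dist_le _ _ h').2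
      omega
  unfold degree
  rw [h1, h2, ← card_union_of_disjoint]
  · have : (univ.filter fun u => (v, u) ∈ T) ∪ (univ.filter fun u => (u, v) ∈ T) =
        univ.erase v := by
      ext u
      simp only [mem_union, mem_filter, mem_univ, true_and, mem_erase, and_true]
      constructor
      · rintro (h | h)
        · exact fun h' => (hT.dist_le _ _ h).1 h'.symm
        · exact (hT.dist_le _ _ h).1
      · intro h
        rcases key u h with h | h
        · exact Or.inl h.1
        · exact Or.inr h.1
    rw [this, card_erase_of_mem (mem_univ v), card_univ, Fintype.card_fin]
  · rw [disjoint_left]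
    intro u hu hu'
    simp only [mem_filter, mem_univ, true_and] at hu hu'
    rcases key u (hT.dist_le _ _ hu').1 with h | h
    · exact h.2 hu'
    · exact h.2 hu

lemma sum_degree_parts {N : ℕ} {T : Finset (Fin N × Fin N)} (P : Finpartition T) (v : Fin N) :
    ∑ B ∈ P.parts, degree B v = degree T v := by
  have h : ∀ p : Fin N × Fin N → Prop, [DecidablePred p] →
      ∑ B ∈ P.parts, (B.filter p).card = (T.filter p).card := by
    intro p _
    conv_rhs => rw [← P.biUnion_parts, filter_biUnion]
    rw [card_biUnion]
    · rfl
    · intro A hA B hB hAB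
      exact disjoint_filter_filter (P.disjoint hA hB hAB)
  unfold degree outs ins
  rw [sum_add_distrib, h, h]

/-- Lower bound from a subadditive weight of degrees. -/
lemma weight_le_adm {N : ℕ} (g : ℕ → ℕ) (c a d : ℕ) (h0 : g 0 = 0)
    (hg : ∀ o i, o ≤ 3 → i ≤ 3 → 1 ≤ o + i → g (o + i) + (if o + i ≤ 2 then a else 0) ≤
      c + ((if o = 3 then a else 0) + (if i = 3 then a else 0)))
    (hadd : ∀ m n, g (m + n) ≤ g m + g n) (hd : d ≤ g (N - 1)) :
    N * d ≤ c * adm 3 N := by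
  obtain ⟨T, hT, P, hP, hA⟩ := isCost_adm 3 N (by norm_num)
  rw [← hA, mul_sum]
  calc N * d = ∑ _v : Fin N, d := by simp
    _ ≤ ∑ v : Fin N, ∑ B ∈ P.parts, g (degree B v) := by
        refine sum_le_sum fun v _ => ?_
        refine hd.trans ?_
        rw [← degree_tournament hT v, ← sum_degree_parts P v]
        exact le_sum_of_subadditive g h0.le hadd _ _
    _ = ∑ B ∈ P.parts, ∑ v : Fin N, g (degree B v) := sum_comm
    _ ≤ _ := sum_le_sum fun B hB => sum_weight_le (hP B hB)
        (fun r hr => (hT.dist_le r.1 r.2 (P.le hB hr)).1) g c a h0 hg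

lemma even_lower {N : ℕ} (hN : N ≡ 0 [MOD 2]) : N * N ≤ 4 * adm 3 N := by
  -- Rounding the degree up to an even number is subadditive and turns N - 1 into N. The weight is
  -- at most 4 for degrees up to four; degrees five and six weigh 6, and the excess 2 is the slack
  -- left at degree one or two.
  refine weight_le_adm (fun d => d + d % 2) 4 2 N rfl ?_ ?_ ?_
  · intro o i ho hi h
    split_ifs <;> omega
  · intro m n
    omega
  · have : N % 2 = 0 := hN
    omega

lemma odd_lower {N : ℕ} (hN : N ≡ 3 [MOD 4]) : N * (3 * N - 1) ≤ 12 * adm 3 N := by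
  -- The second summand is the distance of `d` to the nearest multiple of four, hence subadditive,
  -- and N - 1 ≡ 2 mod 4 makes it equal to 2. The weights of degrees 1, …, 6 are 4, 8, 10, 12, 16,
  -- 20.
  refine weight_le_adm (fun d => 3 * d + (if d % 4 = 0 then 0 else if d % 4 = 2 then 2 else 1))
    12 4 (3 * N - 1) rfl ?_ ?_ ?_
  · intro o i ho hi h
    split_ifs <;> omega
  · intro m n
    split_ifs <;> omega
  · have : N % 4 = 3 := hN
    split_ifs <;> omega

/-! ### Covers in place of partitions, and relabelling of vertices -/

/-- The ring arcs in the relation `S` can be covered by graphs of load at most three with `A`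
vertices in total. -/
def Coverable {N : ℕ} (S : Fin N → Fin N → Prop) (A : ℕ) : Prop :=
  ∃ L : List (Finset (Fin N × Fin N)), (∀ B ∈ L, ∀ e, load B e ≤ 3) ∧
    (∀ u v, S u v → ∃ B ∈ L, (u, v) ∈ B) ∧ (L.map fun B => (nodes B).card).sum ≤ A

lemma load_mono {N : ℕ} {B B' : Finset (Fin N × Fin N)} (h : B ⊆ B') (e : Fin N) :
    load B e ≤ load B' e :=
  card_le_card (filter_subset_filter _ h)

lemma nodes_mono {N : ℕ} {B B' : Finset (Fin N × Fin N)} (h : B ⊆ B') : nodes B ⊆ nodes B' :=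
  union_subset_union (image_subset_image h) (image_subset_image h)

lemma Coverable.mono {N : ℕ} {S S' : Fin N → Fin N → Prop} {A A' : ℕ} (h : Coverable S A)
    (hS : ∀ u v, S' u v → S u v) (hA : A ≤ A') : Coverable S' A' := by
  obtain ⟨L, h1, h2, h3⟩ := h
  exact ⟨L, h1, fun u v huv => h2 u v (hS u v huv), h3.trans hA⟩

lemma Coverable.or {N : ℕ} {S S' : Fin N → Fin N → Prop} {A A' : ℕ} (h : Coverable S A)
    (h' : Coverable S' A') : Coverable (fun u v => S u v ∨ S' u v) (A + A') := by
  obtain ⟨L, h1, h2, h3⟩ := h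
  obtain ⟨L', h1', h2', h3'⟩ := h'
  refine ⟨L ++ L', fun B hB => ?_, fun u v huv => ?_, ?_⟩
  · rcases List.mem_append.1 hB with hB | hB
    · exact h1 B hB
    · exact h1' B hB
  · rcases huv with huv | huv
    · obtain ⟨B, hB, hr⟩ := h2 u v huv
      exact ⟨B, List.mem_append_left _ hB, hr⟩
    · obtain ⟨B, hB, hr⟩ := h2' u v huv
      exact ⟨B, List.mem_append_right _ hB, hr⟩
  · rw [List.map_append, List.sum_append]
    omega

lemma Coverable.bUnion {N : ℕ} {ι : Type*} (s : Finset ι) (S : ι → Fin N → Fin N → Prop)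
    (A : ι → ℕ) (h : ∀ k ∈ s, Coverable (S k) (A k)) :
    Coverable (fun u v => ∃ k ∈ s, S k u v) (∑ k ∈ s, A k) := by
  classical
  induction s using Finset.induction_on with
  | empty => exact ⟨[], by simp, by simp, by simp⟩
  | insert k s hk ih =>
    rw [sum_insert hk]
    refine ((h k (mem_insert_self k s)).or
      (ih fun j hj => h j (mem_insert_of_mem hj))).mono ?_ le_rfl
    rintro u v ⟨j, hj, huv⟩
    rcases mem_insert.1 hj with rfl | hj
    · exact Or.inl huv
    · exact Or.inr ⟨j, hj, huv⟩

/-- A strictly monotone relabelling of the ring vertices does not increase the load. -/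
lemma load_image_le {M N : ℕ} {f : Fin M → Fin N} (hf : StrictMono f)
    {B : Finset (Fin M × Fin M)} (hB : ∀ e, load B e ≤ 3) (e : Fin N) :
    load (B.image (Prod.map f f)) e ≤ 3 := by
  rcases Nat.eq_zero_or_pos M with rfl | hM
  · have : B = ∅ := by
      rw [eq_empty_iff_forall_notMem]
      exact fun r => r.1.elim0
    simp [this, load]
  have hval : ∀ i j : Fin M, (f i).val < (f j).val ↔ i.val < j.val := fun i j => by
    rw [← Fin.lt_def, ← Fin.lt_def, hf.lt_iff_lt]
  -- `e'` is the last old vertex whose image is not after `e`. If all images lie after `e`, the ring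
  -- arc at `e` is in the gap that contains the cut, which corresponds to the last old vertex.
  obtain ⟨e', he'⟩ : ∃ e' : Fin M, (∀ i : Fin M, (f i).val ≤ e.val ↔ i.val ≤ e'.val) ∨
      ((∀ i : Fin M, e.val < (f i).val) ∧ ∀ i : Fin M, i.val ≤ e'.val) := by
    by_cases hex : ∃ i : Fin M, (f i).val ≤ e.val
    · obtain ⟨i, hi⟩ := hex
      obtain ⟨e', he', hmax⟩ := exists_max_image (univ.filter fun i : Fin M => (f i).val ≤ e.val)
        (fun i => i.val) ⟨i, mem_filter.2 ⟨mem_univ i, hi⟩⟩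
      refine ⟨e', Or.inl fun j => ⟨fun h => hmax j (mem_filter.2 ⟨mem_univ j, h⟩), fun h => ?_⟩⟩
      have h1 := (mem_filter.1 he').2
      have h2 := hval e' j
      omega
    · push Not at hex
      exact ⟨⟨M - 1, by omega⟩, Or.inr ⟨hex, fun i => by have := i.isLt; dsimp only; omega⟩⟩
  refine le_trans ?_ (hB e')
  unfold load
  rw [filter_image]
  refine card_image_le.trans (card_le_card fun r hr => ?_)
  obtain ⟨hr, hu⟩ := mem_filter.1 hr
  refine mem_filter.2 ⟨hr, ?_⟩
  obtain ⟨i, j⟩ := r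
  have h1 := hval i j
  have h2 := hval j i
  have := i.isLt
  have := j.isLt
  rw [Prod.map_apply, uses_iff] at hu
  rw [uses_iff]
  rcases he' with he' | ⟨he1, he2⟩
  · have h3 := he' i
    have h4 := he' j
    omega
  · have h3 := he1 i
    have h4 := he1 j
    have h5 := he2 i
    have h6 := he2 j
    omega

lemma Coverable.map {M N : ℕ} {f : Fin M → Fin N} (hf : StrictMono f)
    {S : Fin M → Fin M → Prop} {A : ℕ} (h : Coverable S A) :
    Coverable (fun u v => ∃ i j, S i j ∧ f i = u ∧ f j = v) A := by
  obtain ⟨L, h1, h2, h3⟩ := h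
  refine ⟨L.map fun B => B.image (Prod.map f f), ?_, ?_, ?_⟩
  · intro B hB e
    obtain ⟨B', hB', rfl⟩ := List.mem_map.1 hB
    exact load_image_le hf (h1 B' hB') e
  · rintro _ _ ⟨i, j, hij, rfl, rfl⟩
    obtain ⟨B, hB, hr⟩ := h2 i j hij
    exact ⟨_, List.mem_map_of_mem hB, mem_image.2 ⟨(i, j), hr, rfl⟩⟩
  · rw [List.map_map]
    refine le_trans (List.sum_le_sum fun B _ => ?_) h3
    have : nodes (B.image (Prod.map f f)) = (nodes B).image f := by
      unfold nodes
      rw [image_union, image_image, image_image, image_image, image_image]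
      rfl
    simp only [Function.comp_apply, this]
    exact card_image_le

/-- Each graph of the list takes the arcs that no later graph takes. Passing to subgraphs increases
neither load nor vertex set, so overlapping covers are as good as partitions. -/
lemma exists_finpartition {N : ℕ} (L : List (Finset (Fin N × Fin N))) :
    ∀ T : Finset (Fin N × Fin N), (∀ r ∈ T, ∃ B ∈ L, r ∈ B) →
      ∃ P : Finpartition T, (∀ p ∈ P.parts, ∃ B ∈ L, p ⊆ B) ∧
        ∑ p ∈ P.parts, (nodes p).card ≤ (L.map fun B => (nodes B).card).sum := by
  induction L with
  | nil =>
    intro T hT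
    obtain rfl : T = ∅ := by
      rw [eq_empty_iff_forall_notMem]
      intro r hr
      simpa using hT r hr
    exact ⟨Finpartition.empty _, by simp, by simp⟩
  | cons B L ih =>
    intro T hT
    obtain ⟨P, hP, hsum⟩ := ih (T \ B) (by
      intro r hr
      obtain ⟨hr, hrB⟩ := mem_sdiff.1 hr
      obtain ⟨B', hB', h⟩ := hT r hr
      rcases List.mem_cons.1 hB' with rfl | hB'
      · exact absurd h hrB
      · exact ⟨B', hB', h⟩)
    -- The parts of a `Finpartition` are nonempty, so a graph that contributes no new arc is
    -- dropped.
    by_cases hTB : T ∩ B = ∅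
    · have hTB' : T \ B = T := sdiff_eq_self_of_disjoint (disjoint_iff_inter_eq_empty.2 hTB)
      refine ⟨P.copy hTB', fun p hp => ?_, ?_⟩
      · obtain ⟨B', hB', h⟩ := hP p hp
        exact ⟨B', List.mem_cons_of_mem _ hB', h⟩
      · rw [List.map_cons, List.sum_cons]
        exact hsum.trans (Nat.le_add_left _ _)
    · refine ⟨P.extend (b := T ∩ B) hTB ?_ ?_, ?_, ?_⟩
      · exact (disjoint_sdiff_self_left).mono_right inter_subset_right
      · exact sdiff_union_inter T B
      · intro p hp
        rcases mem_insert.1 hp with rfl | hp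
        · exact ⟨B, List.mem_cons_self, inter_subset_right⟩
        · obtain ⟨B', hB', h⟩ := hP p hp
          exact ⟨B', List.mem_cons_of_mem _ hB', h⟩
      · rw [List.map_cons, List.sum_cons]
        have h1 : (nodes (T ∩ B)).card ≤ (nodes B).card :=
          card_le_card (nodes_mono inter_subset_right)
        change ∑ p ∈ insert (T ∩ B) P.parts, (nodes p).card ≤ _
        by_cases hmem : T ∩ B ∈ P.parts
        · rw [insert_eq_of_mem hmem]
          omega
        · rw [sum_insert hmem]
          omega

lemma adm_le_of_coverable {N A : ℕ} {T : Finset (Fin N × Fin N)} (hT : IsRequestTournament T)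
    (h : Coverable (fun u v => (u, v) ∈ T) A) : adm 3 N ≤ A := by
  obtain ⟨L, h1, h2, h3⟩ := h
  obtain ⟨P, hP, hsum⟩ := exists_finpartition L T fun r hr => h2 r.1 r.2 hr
  refine le_trans (Nat.sInf_le ⟨T, hT, P, fun p hp e => ?_, rfl⟩) (hsum.trans h3)
  obtain ⟨B, hB, h⟩ := hP p hp
  exact (load_mono h e).trans (h1 B hB e)

/-! ### Points as pairs of vertices half a ring apart -/

/-- On a ring with `2 * n` or `2 * n + 1` vertices, a point `a < n` stands for the two vertices
`a` and `a + n`. The arcs `u → v` belonging to the pair of points `a`, `b`: the circuit through the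
four vertices if `a ≠ b`; the arc from `a` to `a + n`, completed by the last vertex `2 * n` to a
circuit if this vertex exists, if `a = b`. -/
def PairArc (n a b u v : ℕ) : Prop :=
  (a < b ∧ ((u = a ∧ v = b) ∨ (u = b ∧ v = a + n) ∨ (u = a + n ∧ v = b + n) ∨
    (u = b + n ∧ v = a))) ∨
  (b < a ∧ ((u = b ∧ v = a) ∨ (u = a ∧ v = b + n) ∨ (u = b + n ∧ v = a + n) ∨
    (u = a + n ∧ v = b))) ∨
  (a = b ∧ ((u = a ∧ v = a + n) ∨ (u = a + n ∧ v = 2 * n) ∨ (u = 2 * n ∧ v = a)))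

instance (n a b u v : ℕ) : Decidable (PairArc n a b u v) :=
  inferInstanceAs (Decidable (_ ∨ _ ∨ _))

/-- The ring arcs belonging to the pairs of points in the relation `R` can be covered by graphs of
load at most three with `A` vertices in total. -/
def PairCoverable (δ : ℕ) {n : ℕ} (R : Fin n → Fin n → Prop) (A : ℕ) : Prop :=
  Coverable (N := 2 * n + δ) (fun u v => ∃ a b, R a b ∧ PairArc n a b u v) A

lemma PairCoverable.mono {δ n A A' : ℕ} {R R' : Fin n → Fin n → Prop}
    (h : PairCoverable δ R A) (hR : ∀ a b, R' a b → R a b) (hA : A ≤ A') :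
    PairCoverable δ R' A' :=
  Coverable.mono h (fun _ _ ⟨a, b, hab, h⟩ => ⟨a, b, hR a b hab, h⟩) hA

lemma PairCoverable.or {δ n A A' : ℕ} {R R' : Fin n → Fin n → Prop}
    (h : PairCoverable δ R A) (h' : PairCoverable δ R' A') :
    PairCoverable δ (fun a b => R a b ∨ R' a b) (A + A') :=
  (Coverable.or h h').mono (by
    rintro u v ⟨a, b, hab | hab, h⟩
    · exact Or.inl ⟨a, b, hab, h⟩
    · exact Or.inr ⟨a, b, hab, h⟩) le_rfl

lemma PairCoverable.bUnion {δ n : ℕ} {ι : Type*} (s : Finset ι) (R : ι → Fin n → Fin n → Prop)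
    (A : ι → ℕ) (h : ∀ k ∈ s, PairCoverable δ (R k) (A k)) :
    PairCoverable δ (fun a b => ∃ k ∈ s, R k a b) (∑ k ∈ s, A k) :=
  (Coverable.bUnion s _ A h).mono (by
    rintro u v ⟨a, b, ⟨k, hk, hab⟩, h⟩
    exact ⟨k, hk, a, b, hab, h⟩) le_rfl

/-- The map of ring vertices induced by a map of points. -/
def ringMap (δ : ℕ) {m n : ℕ} (f : Fin m → Fin n) (hδ : δ ≤ 1) (u : Fin (2 * m + δ)) :
    Fin (2 * n + δ) :=
  if h : u.val < m then ⟨f ⟨u.val, h⟩, by have := (f ⟨u.val, h⟩).isLt; omega⟩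
  else if h' : u.val < 2 * m then
    ⟨f ⟨u.val - m, by omega⟩ + n, by have := (f ⟨u.val - m, by omega⟩).isLt; omega⟩
  else ⟨2 * n, by have := u.isLt; omega⟩

lemma ringMap_fst {δ m n : ℕ} (f : Fin m → Fin n) (hδ : δ ≤ 1) {u : Fin (2 * m + δ)} (a : Fin m)
    (h : u.val = a.val) : (ringMap δ f hδ u).val = f a := by
  have := a.isLt
  have hu : u.val < m := by omega
  simp [ringMap, h]

lemma ringMap_snd {δ m n : ℕ} (f : Fin m → Fin n) (hδ : δ ≤ 1) {u : Fin (2 * m + δ)} (a : Fin m)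
    (h : u.val = a.val + m) : (ringMap δ f hδ u).val = f a + n := by
  have := a.isLt
  have h1 : ¬ a.val + m < m := by omega
  have h2 : a.val + m < 2 * m := by omega
  simp [ringMap, h, h2]

lemma ringMap_last {δ m n : ℕ} (f : Fin m → Fin n) (hδ : δ ≤ 1) {u : Fin (2 * m + δ)}
    (h : u.val = 2 * m) : (ringMap δ f hδ u).val = 2 * n := by
  have h1 : ¬ 2 * m < m := by omega
  simp [ringMap, h, h1]

lemma ringMap_cases {δ m n : ℕ} (f : Fin m → Fin n) (hδ : δ ≤ 1) (u : Fin (2 * m + δ)) :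
    (∃ a : Fin m, u.val = a.val ∧ (ringMap δ f hδ u).val = f a) ∨
      (∃ a : Fin m, u.val = a.val + m ∧ (ringMap δ f hδ u).val = f a + n) ∨
      (u.val = 2 * m ∧ (ringMap δ f hδ u).val = 2 * n) := by
  have := u.isLt
  rcases lt_or_ge u.val m with h | h
  · exact Or.inl ⟨⟨u.val, h⟩, rfl, ringMap_fst f hδ _ rfl⟩
  rcases lt_or_ge u.val (2 * m) with h' | h'
  · have h2 : u.val = (u.val - m) + m := by omega
    exact Or.inr (Or.inl ⟨⟨u.val - m, by omega⟩, h2, ringMap_snd f hδ _ h2⟩)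
  · have h2 : u.val = 2 * m := by omega
    exact Or.inr (Or.inr ⟨h2, ringMap_last f hδ h2⟩)

lemma ringMap_strictMono {δ m n : ℕ} {f : Fin m → Fin n} (hf : StrictMono f) (hδ : δ ≤ 1) :
    StrictMono (ringMap δ f hδ) := by
  intro u v huv
  have hval : ∀ i j : Fin m, i.val < j.val → (f i).val < (f j).val := fun i j h => hf h
  rw [Fin.lt_def] at huv ⊢
  rcases ringMap_cases f hδ u with ⟨a, h1, h2⟩ | ⟨a, h1, h2⟩ | ⟨h1, h2⟩ <;>
    rcases ringMap_cases f hδ v with ⟨b, h3, h4⟩ | ⟨b, h3, h4⟩ | ⟨h3, h4⟩ <;> rw [h2, h4]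
  · exact hval a b (by omega)
  · have := (f a).isLt; omega
  · have := (f a).isLt; omega
  · have := a.isLt; have := b.isLt; omega
  · have := hval a b (by omega); omega
  · have := (f a).isLt; omega
  · have := b.isLt; omega
  · have := b.isLt; omega
  · omega

/-- A strictly increasing map of points induces a strictly increasing map of ring vertices, because
all `a` precede all `a + n`, which precede `2 * n`. It carries circuits of pairs to circuits of
pairs, so a cover found for few points can be used on any ring. Monotonicity is essential: loads
depend on the cyclic order. -/
lemma PairCoverable.map {δ m n A : ℕ} {f : Fin m → Fin n} (hf : StrictMono f) (hδ : δ ≤ 1)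
    {R : Fin m → Fin m → Prop} (h : PairCoverable δ R A) :
    PairCoverable δ (fun a b => ∃ i j, R i j ∧ f i = a ∧ f j = b) A := by
  refine (Coverable.map (ringMap_strictMono hf hδ) h).mono ?_ le_rfl
  rintro u v ⟨_, _, ⟨i, j, hij, rfl, rfl⟩, huv⟩
  have hval : ∀ i j : Fin m, (f i).val < (f j).val ↔ i.val < j.val := fun i j => by
    rw [← Fin.lt_def, ← Fin.lt_def, hf.lt_iff_lt]
  have e1 := hval i j
  have e2 := hval j i
  have key : ∀ w : Fin (2 * n + δ), (w.val = (f i).val → ∃ w' : Fin (2 * m + δ), w'.val = i.val ∧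
      ringMap δ f hδ w' = w) ∧ (w.val = (f i).val + n → ∃ w' : Fin (2 * m + δ),
      w'.val = i.val + m ∧ ringMap δ f hδ w' = w) ∧
      (w.val = (f j).val → ∃ w' : Fin (2 * m + δ), w'.val = j.val ∧
      ringMap δ f hδ w' = w) ∧ (w.val = (f j).val + n → ∃ w' : Fin (2 * m + δ),
      w'.val = j.val + m ∧ ringMap δ f hδ w' = w) ∧
      (w.val = 2 * n → ∃ w' : Fin (2 * m + δ), w'.val = 2 * m ∧ ringMap δ f hδ w' = w) := by
    intro w
    have := i.isLt
    have := j.isLt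
    have := w.isLt
    exact ⟨fun h => ⟨⟨i.val, by omega⟩, rfl, Fin.ext ((ringMap_fst f hδ i rfl).trans h.symm)⟩,
      fun h => ⟨⟨i.val + m, by omega⟩, rfl, Fin.ext ((ringMap_snd f hδ i rfl).trans h.symm)⟩,
      fun h => ⟨⟨j.val, by omega⟩, rfl, Fin.ext ((ringMap_fst f hδ j rfl).trans h.symm)⟩,
      fun h => ⟨⟨j.val + m, by omega⟩, rfl, Fin.ext ((ringMap_snd f hδ j rfl).trans h.symm)⟩,
      fun h => ⟨⟨2 * m, by omega⟩, rfl, Fin.ext ((ringMap_last f hδ rfl).trans h.symm)⟩⟩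
  have e3 : (f i).val = (f j).val → i.val = j.val := fun h => by omega
  have ku := key u
  have kv := key v
  have main : ∀ {x y : ℕ}, (∃ w' : Fin (2 * m + δ), w'.val = x ∧ ringMap δ f hδ w' = u) →
      (∃ w' : Fin (2 * m + δ), w'.val = y ∧ ringMap δ f hδ w' = v) → PairArc m i j x y →
      ∃ i' j' : Fin (2 * m + δ), (∃ a b, R a b ∧ PairArc m a b i' j') ∧ ringMap δ f hδ i' = u ∧
        ringMap δ f hδ j' = v := by
    rintro x y ⟨w, rfl, hw⟩ ⟨w', rfl, hw'⟩ hp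
    exact ⟨w, w', ⟨i, j, hij, hp⟩, hw, hw'⟩
  rcases huv with ⟨hlt, h | h | h | h⟩ | ⟨hlt, h | h | h | h⟩ | ⟨heq, h | h | h⟩ <;>
    obtain ⟨h1, h2⟩ := h
  · exact main (ku.1 h1) (kv.2.2.1 h2) (Or.inl ⟨e1.1 hlt, Or.inl ⟨rfl, rfl⟩⟩)
  · exact main (ku.2.2.1 h1) (kv.2.1 h2) (Or.inl ⟨e1.1 hlt, Or.inr (Or.inl ⟨rfl, rfl⟩)⟩)
  · exact main (ku.2.1 h1) (kv.2.2.2.1 h2)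
      (Or.inl ⟨e1.1 hlt, Or.inr (Or.inr (Or.inl ⟨rfl, rfl⟩))⟩)
  · exact main (ku.2.2.2.1 h1) (kv.1 h2)
      (Or.inl ⟨e1.1 hlt, Or.inr (Or.inr (Or.inr ⟨rfl, rfl⟩))⟩)
  · exact main (ku.2.2.1 h1) (kv.1 h2) (Or.inr (Or.inl ⟨e2.1 hlt, Or.inl ⟨rfl, rfl⟩⟩))
  · exact main (ku.1 h1) (kv.2.2.2.1 h2)
      (Or.inr (Or.inl ⟨e2.1 hlt, Or.inr (Or.inl ⟨rfl, rfl⟩)⟩))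
  · exact main (ku.2.2.2.1 h1) (kv.2.1 h2)
      (Or.inr (Or.inl ⟨e2.1 hlt, Or.inr (Or.inr (Or.inl ⟨rfl, rfl⟩))⟩))
  · exact main (ku.2.1 h1) (kv.2.2.1 h2)
      (Or.inr (Or.inl ⟨e2.1 hlt, Or.inr (Or.inr (Or.inr ⟨rfl, rfl⟩))⟩))
  · exact main (ku.1 h1) (kv.2.1 h2)
      (Or.inr (Or.inr ⟨e3 heq, Or.inl ⟨rfl, rfl⟩⟩))
  · exact main (ku.2.1 h1) (kv.2.2.2.2 h2)
      (Or.inr (Or.inr ⟨e3 heq, Or.inr (Or.inl ⟨rfl, rfl⟩)⟩))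
  · exact main (ku.2.2.2.2 h1) (kv.1 h2)
      (Or.inr (Or.inr ⟨e3 heq, Or.inr (Or.inr ⟨rfl, rfl⟩)⟩))

/-- The request tournament consisting of all arcs that belong to pairs of points. -/
def pairTournament (n δ : ℕ) : Finset (Fin (2 * n + δ) × Fin (2 * n + δ)) :=
  univ.filter fun r => ∃ a b : Fin n, PairArc n a b r.1 r.2

lemma mem_pairTournament {n δ : ℕ} {u v : Fin (2 * n + δ)} :
    (u, v) ∈ pairTournament n δ ↔ ∃ a b : Fin n, PairArc n a b u v := by
  simp [pairTournament]

/-- The arcs obtained are those of length at most `n`, except that on an even ring the antipodal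
arcs run only from `a` to `a + n`. -/
lemma mem_pairTournament_iff {n δ : ℕ} (hδ : δ ≤ 1) {u v : Fin (2 * n + δ)} :
    (u, v) ∈ pairTournament n δ ↔ (u.val < v.val ∧ v.val ≤ u.val + n ∧ (u.val < n ∨ v.val < 2 * n ∨
      v.val = 2 * n)) ∨ (v.val < u.val ∧ v.val + n < u.val) := by
  have := u.isLt
  have := v.isLt
  rw [mem_pairTournament]
  constructor
  · rintro ⟨a, b, h⟩
    have := a.isLt
    have := b.isLt
    unfold PairArc at h
    omega
  · intro h
    have mk : ∀ a b : ℕ, a < n → b < n → PairArc n a b u v →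
        ∃ a b : Fin n, PairArc n a b u v := fun a b ha hb h => ⟨⟨a, ha⟩, ⟨b, hb⟩, h⟩
    unfold PairArc at mk
    rcases lt_or_ge u.val n with hu | hu
    · rcases lt_or_ge v.val n with hv | hv
      · exact mk u v hu hv (by omega)
      · exact mk u (v - n) hu (by omega) (by omega)
    · rcases lt_or_ge u.val (2 * n) with hu' | hu'
      · rcases lt_or_ge v.val n with hv | hv
        · exact mk (u - n) v (by omega) hv (by omega)
        · rcases lt_or_ge v.val (2 * n) with hv' | hv'
          · exact mk (u - n) (v - n) (by omega) (by omega) (by omega)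
          · exact mk (u - n) (u - n) (by omega) (by omega) (by omega)
      · exact mk v v (by omega) (by omega) (by omega)

lemma isRequestTournament_pairTournament {n δ : ℕ} (hδ : δ ≤ 1) :
    IsRequestTournament (pairTournament n δ) := by
  refine ⟨fun i j h => ?_, fun i j hij h => ?_, fun i j h => ?_⟩
  · rw [mem_pairTournament_iff hδ] at h
    have := i.isLt
    have := j.isLt
    refine ⟨fun hij => ?_, ?_⟩
    · rw [hij] at h; omega
    · rcases ringDist_cases i j with h' | h' <;> omega
  · rw [mem_pairTournament_iff hδ]
    have hij' : i.val ≠ j.val := fun h => hij (Fin.ext h)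
    have := i.isLt
    have := j.isLt
    rcases ringDist_cases i j with h' | h' <;> omega
  · unfold Xor
    rw [mem_pairTournament_iff hδ, mem_pairTournament_iff hδ]
    have := i.isLt
    have := j.isLt
    rcases ringDist_cases i j with h' | h' <;> omega

lemma adm_le_of_pairCoverable {δ n A : ℕ} (hδ : δ ≤ 1)
    (h : PairCoverable δ (fun _ _ : Fin n => True) A) : adm 3 (2 * n + δ) ≤ A := by
  refine adm_le_of_coverable (isRequestTournament_pairTournament hδ)
    (Coverable.mono h (fun u v huv => ?_) le_rfl)
  obtain ⟨a, b, hab⟩ := mem_pairTournament.1 huv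
  exact ⟨a, b, trivial, hab⟩

/-! ### Gadgets and the Boolean test of their covers -/

/-- A configuration on `size` points: triples, and further pairs. -/
structure Gadget where
  size : ℕ
  triples : Finset (Finset (Fin size))
  pairs : Finset (Fin size × Fin size)

/-- Two points are related by a gadget if they are distinct points of one of its triples or form
one of its pairs. -/
def Gadget.Rel (G : Gadget) (i j : Fin G.size) : Prop :=
  (∃ t ∈ G.triples, i ≠ j ∧ i ∈ t ∧ j ∈ t) ∨ (i, j) ∈ G.pairs

/-- The gadget can be covered with `x` vertices more than six for each of its triples. -/
def Gadget.Extra (δ : ℕ) (G : Gadget) (x : ℕ) : Prop :=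
  PairCoverable δ G.Rel (6 * G.triples.card + x)

/-- The arcs belonging to the pair of points `a ≤ b`, as a list. -/
def pairArcs (δ n a b : ℕ) : List (ℕ × ℕ) :=
  if a = b then (a, a + n) :: if δ = 0 then [] else [(a + n, 2 * n), (2 * n, a)]
  else [(a, b), (b, a + n), (a + n, b + n), (b + n, a)]

/-- `Uses` for natural numbers, as a Boolean. -/
def natUses (e : ℕ) (r : ℕ × ℕ) : Bool :=
  (Nat.ble r.1 e && Nat.blt e r.2) || (Nat.blt r.2 r.1 && (Nat.ble r.1 e || Nat.blt e r.2))

/-- The list `L` of graphs covers the pairs of points in the list `E`, with loads at most three and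
at most `A` vertices in total. -/
def coverCheck (δ n A : ℕ) (E : List (ℕ × ℕ)) (L : List (List (ℕ × ℕ))) : Bool :=
  (L.all fun l => (List.range (2 * n + δ)).all fun e => Nat.ble (l.filter (natUses e)).length 3) &&
  (E.all fun p => (pairArcs δ n p.1 p.2).all fun r => L.any fun l => l.contains r) &&
  Nat.ble (L.map fun l => (l.map Prod.fst ++ l.map Prod.snd).dedup.length).sum A

lemma natUses_eq_true {N : ℕ} {r : Fin N × Fin N} {e : Fin N} (h : Uses r e) :
    natUses e.val (r.1.val, r.2.val) = true := by
  have := uses_iff.1 h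
  simp only [natUses, Bool.or_eq_true, Bool.and_eq_true, Nat.ble_eq, Nat.blt_eq]
  omega

lemma mem_pairArcs {δ n a b u v : ℕ} (hδ : δ ≤ 1) (hu : u < 2 * n + δ) (hv : v < 2 * n + δ)
    (h : PairArc n a b u v) : (u, v) ∈ pairArcs δ n (min a b) (max a b) := by
  unfold PairArc at h
  unfold pairArcs
  rcases lt_trichotomy a b with hab | rfl | hab
  · rw [min_eq_left hab.le, max_eq_right hab.le, if_neg hab.ne]
    simp only [List.mem_cons, Prod.mk.injEq, List.not_mem_nil, or_false]
    omega
  · rw [min_self, max_self, if_pos rfl]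
    split_ifs with h0
    · simp only [List.mem_cons, Prod.mk.injEq, List.not_mem_nil, or_false]
      omega
    · simp only [List.mem_cons, Prod.mk.injEq, List.not_mem_nil, or_false]
      omega
  · rw [min_eq_right hab.le, max_eq_left hab.le, if_neg hab.ne]
    simp only [List.mem_cons, Prod.mk.injEq, List.not_mem_nil, or_false]
    omega

/-- The covers are tested as lists of natural numbers, which the kernel evaluates; here the test is
transferred to finsets of arcs on the ring. -/
lemma pairCoverable_of_coverCheck {δ n A : ℕ} (hδ : δ ≤ 1) {R : Fin n → Fin n → Prop}
    (E : List (ℕ × ℕ)) (L : List (List (ℕ × ℕ)))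
    (hR : ∀ a b, R a b → (min a.val b.val, max a.val b.val) ∈ E)
    (hc : coverCheck δ n A E L = true) : PairCoverable δ R A := by
  simp only [coverCheck, Bool.and_eq_true, List.all_eq_true, List.any_eq_true, Nat.ble_eq,
    List.contains_iff_mem, List.mem_range] at hc
  obtain ⟨⟨h1, h2⟩, h3⟩ := hc
  let gr : List (ℕ × ℕ) → Finset (Fin (2 * n + δ) × Fin (2 * n + δ)) := fun l =>
    univ.filter fun r => (r.1.val, r.2.val) ∈ l
  have hgr : ∀ l r, r ∈ gr l ↔ (r.1.val, r.2.val) ∈ l := fun l r => by simp [gr]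
  refine ⟨L.map gr, fun B hB e => ?_, ?_, ?_⟩
  · obtain ⟨l, hl, rfl⟩ := List.mem_map.1 hB
    refine le_trans ?_ (h1 l hl e.val e.isLt)
    refine le_trans ?_ (List.toFinset_card_le _)
    refine card_le_card_of_injOn (fun r => (r.1.val, r.2.val)) (fun r hr => ?_) ?_
    · obtain ⟨hr, hu⟩ := mem_filter.1 hr
      exact List.mem_toFinset.2 (List.mem_filter.2 ⟨(hgr l r).1 hr, natUses_eq_true hu⟩)
    · intro r _ s _ h
      obtain ⟨h, h'⟩ := Prod.mk.inj h
      exact Prod.ext (Fin.ext h) (Fin.ext h')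
  · rintro u v ⟨a, b, hab, huv⟩
    obtain ⟨l, hl, h⟩ := h2 _ (hR a b hab) _ (mem_pairArcs hδ u.isLt v.isLt huv)
    exact ⟨gr l, List.mem_map_of_mem hl, (hgr l _).2 h⟩
  · rw [List.map_map]
    refine le_trans (List.sum_le_sum fun l _ => ?_) h3
    rw [Function.comp_apply, ← List.card_toFinset]
    refine card_le_card_of_injOn (fun u => u.val) (fun u hu => ?_) ?_
    · rw [mem_coe, List.mem_toFinset, List.mem_append, List.mem_map, List.mem_map]
      rcases mem_nodes.1 hu with ⟨w, hw⟩ | ⟨w, hw⟩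
      · exact Or.inl ⟨_, (hgr l _).1 hw, rfl⟩
      · exact Or.inr ⟨_, (hgr l _).1 hw, rfl⟩
    · intro u _ v _ h
      exact Fin.ext h

lemma pairCoverable_triangle {δ : ℕ} (hδ : δ ≤ 1) :
    PairCoverable δ (fun i j : Fin 3 => i ≠ j) 6 := by
  obtain rfl | rfl : δ = 0 ∨ δ = 1 := by omega
  all_goals
    exact pairCoverable_of_coverCheck (by norm_num) [(0, 1), (0, 2), (1, 2)]
      -- The union of the three circuits of load one.
      [[(0, 1), (1, 3), (3, 4), (4, 0), (0, 2), (2, 3), (3, 5), (5, 0), (1, 2), (2, 4), (4, 5),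
        (5, 1)]] (by decide +kernel) (by decide +kernel)

/-- Unlike a general gadget, a triple imposes no condition on the order of its points: they may be
sorted first. -/
lemma pairCoverable_of_card_eq_three {δ n : ℕ} (hδ : δ ≤ 1) {b : Finset (Fin n)}
    (hb : b.card = 3) : PairCoverable δ (fun p q => p ≠ q ∧ p ∈ b ∧ q ∈ b) 6 := by
  refine ((pairCoverable_triangle hδ).map (b.orderEmbOfFin hb).strictMono hδ).mono ?_ le_rfl
  rintro p q ⟨hpq, hp, hq⟩
  obtain ⟨i, rfl⟩ : p ∈ Set.range (b.orderEmbOfFin hb) := by rwa [range_orderEmbOfFin]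
  obtain ⟨j, rfl⟩ : q ∈ Set.range (b.orderEmbOfFin hb) := by rwa [range_orderEmbOfFin]
  exact ⟨i, j, fun h => hpq (congrArg _ h), rfl, rfl⟩

/-! ### The gadgets used, with explicit covers for even and odd rings -/

/-- A single point. -/
def pointGadget : Gadget where
  size := 1
  triples := ∅
  pairs := {(0, 0)}

lemma pointGadget_extra_even : pointGadget.Extra 0 2 :=
  pairCoverable_of_coverCheck (by norm_num)
    [(0, 0)]
    [[(0, 1)]]
    (by unfold Gadget.Rel; decide +kernel) (by decide +kernel)

lemma pointGadget_extra_odd : pointGadget.Extra 1 3 :=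
  pairCoverable_of_coverCheck (by norm_num)
    [(0, 0)]
    [[(0, 1), (1, 2), (2, 0)]]
    (by unfold Gadget.Rel; decide +kernel) (by decide +kernel)

/-- A triple with all pairs that consist of one of its points. -/
def triangleGadget : Gadget where
  size := 3
  triples := {{0, 1, 2}}
  pairs := {(0, 0), (1, 1), (2, 2)}

/-- Splitting the three circuits as two plus one leaves room for one diameter in the first graph and
two in the second. The cost is 6 + 4 vertices, while three separate diameters would cost six extra.
-/
lemma triangleGadget_extra_even : triangleGadget.Extra 0 4 :=
  pairCoverable_of_coverCheck (by norm_num)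
    [(0, 1), (0, 2), (1, 2), (0, 0), (1, 1), (2, 2)]
    [[(0, 1), (1, 3), (3, 4), (4, 0), (1, 2), (2, 4), (4, 5), (5, 1), (1, 4)], [(0, 2), (2, 3),
     (3, 5), (5, 0), (0, 3), (2, 5)]]
    (by unfold Gadget.Rel; decide +kernel) (by decide +kernel)

/-- The six circuits, three from pairs and three through the last vertex, have load six in all. They
are redistributed into two graphs of load three, on seven and five vertices. -/
lemma triangleGadget_extra_odd : triangleGadget.Extra 1 6 :=
  pairCoverable_of_coverCheck (by norm_num)
    [(0, 1), (0, 2), (1, 2), (0, 0), (1, 1), (2, 2)]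
    [[(1, 3), (3, 4), (2, 3), (3, 5), (0, 3), (3, 6), (6, 0), (4, 6), (6, 1), (5, 6), (6, 2)],
     [(0, 1), (4, 0), (0, 2), (5, 0), (1, 2), (2, 4), (4, 5), (5, 1), (1, 4), (2, 5)]]
    (by unfold Gadget.Rel; decide +kernel) (by decide +kernel)

/-- Three triples that form a cycle, with all pairs that consist of one point. -/
def cycleGadget : Gadget where
  size := 6
  triples := {{0, 1, 3}, {1, 2, 4}, {0, 2, 5}}
  pairs := {(0, 0), (1, 1), (2, 2), (3, 3), (4, 4), (5, 5)}

/-- The extra cost per point, 8 / 6, is that of a triangle gadget. The cycle of triples serves where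
disjoint triples are not at hand. -/
lemma cycleGadget_extra_even : cycleGadget.Extra 0 8 :=
  pairCoverable_of_coverCheck (by norm_num)
    [(0, 1), (0, 3), (1, 3), (1, 2), (1, 4), (2, 4), (0, 2), (0, 5), (2, 5), (0, 0), (1, 1), (2, 2), (3, 3), (4, 4), (5, 5)]
    [[(0, 1), (0, 3), (3, 6), (6, 9), (9, 0), (1, 3), (3, 7), (7, 9), (9, 1), (3, 9)], [(0, 5),
     (5, 6), (6, 11), (11, 0), (0, 6), (5, 11)], [(1, 4), (4, 7), (7, 10), (10, 1), (1, 7), (4,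
     10)], [(2, 4), (4, 8), (8, 10), (10, 2), (2, 5), (5, 8), (8, 11), (11, 2), (2, 8)], [(1, 6),
     (6, 7), (7, 0), (1, 2), (2, 7), (7, 8), (8, 1), (0, 2), (2, 6), (6, 8), (8, 0)]]
    (by unfold Gadget.Rel; decide +kernel) (by decide +kernel)

lemma cycleGadget_extra_odd : cycleGadget.Extra 1 12 :=
  pairCoverable_of_coverCheck (by norm_num)
    [(0, 1), (0, 3), (1, 3), (1, 2), (1, 4), (2, 4), (0, 2), (0, 5), (2, 5), (0, 0), (1, 1), (2, 2), (3, 3), (4, 4), (5, 5)]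
    [[(2, 4), (4, 8), (8, 10), (10, 2), (2, 5), (5, 8), (8, 11), (11, 2), (2, 8), (8, 12), (12,
     2)], [(0, 5), (5, 6), (6, 11), (11, 0), (0, 6), (6, 12), (12, 0), (5, 11), (11, 12), (12,
     5)], [(1, 4), (4, 7), (7, 10), (10, 1), (1, 7), (7, 12), (12, 1), (4, 10), (10, 12), (12,
     4)], [(0, 1), (1, 6), (6, 7), (7, 0), (1, 2), (2, 7), (7, 8), (8, 1), (0, 2), (2, 6), (6,
     8), (8, 0)], [(0, 3), (3, 6), (6, 9), (9, 0), (1, 3), (3, 7), (7, 9), (9, 1), (3, 9), (9,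
     12), (12, 3)]]
    (by unfold Gadget.Rel; decide +kernel) (by decide +kernel)

/-- All pairs of five points. -/
def fiveGadget : Gadget where
  size := 5
  triples := ∅
  pairs := {(0, 1), (0, 2), (0, 3), (0, 4), (1, 2), (1, 3), (1, 4), (2, 3), (2, 4), (3, 4), (0, 0), (1, 1), (2, 2), (3, 3), (4, 4)}

lemma fiveGadget_extra_even : fiveGadget.Extra 0 28 :=
  pairCoverable_of_coverCheck (by norm_num)
    [(0, 1), (0, 2), (0, 3), (0, 4), (1, 2), (1, 3), (1, 4), (2, 3), (2, 4), (3, 4), (0, 0), (1, 1), (2, 2), (3, 3), (4, 4)]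
    [[(2, 3), (3, 7), (8, 2), (7, 9), (9, 2), (3, 4), (4, 8), (8, 9), (9, 3), (3, 8)], [(0, 2),
     (7, 0), (8, 0), (1, 2), (2, 6), (6, 7), (6, 8), (1, 4), (4, 6), (2, 4), (4, 7)], [(1, 5),
     (2, 5), (5, 7), (5, 8), (7, 1), (8, 1), (7, 8), (2, 7)], [(0, 4), (4, 5), (5, 9), (0, 5),
     (4, 9)], [(0, 1), (5, 6), (6, 0), (0, 3), (3, 5), (9, 0), (1, 3), (3, 6), (6, 9), (9, 1),
     (1, 6)]]
    (by unfold Gadget.Rel; decide +kernel) (by decide +kernel)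

lemma fiveGadget_extra_odd : fiveGadget.Extra 1 31 :=
  pairCoverable_of_coverCheck (by norm_num)
    [(0, 1), (0, 2), (0, 3), (0, 4), (1, 2), (1, 3), (1, 4), (2, 3), (2, 4), (3, 4), (0, 0), (1, 1), (2, 2), (3, 3), (4, 4)]
    [[(2, 3), (3, 7), (3, 4), (8, 9), (9, 3), (7, 10), (10, 2), (3, 8), (10, 3), (4, 9), (9,
     10)], [(0, 1), (1, 5), (5, 6), (6, 0), (0, 3), (3, 5), (5, 9), (9, 0), (0, 5), (5, 10), (10,
     0)], [(6, 8), (8, 1), (1, 4), (4, 6), (4, 8), (1, 6), (6, 10), (10, 1), (8, 10), (10, 4)],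
     [(0, 2), (2, 5), (5, 7), (7, 0), (5, 8), (8, 0), (0, 4), (4, 5), (7, 8), (8, 2), (2, 4), (4,
     7)], [(1, 2), (2, 6), (6, 7), (7, 1), (1, 3), (3, 6), (6, 9), (9, 1), (7, 9), (9, 2), (2,
     7)]]
    (by unfold Gadget.Rel; decide +kernel) (by decide +kernel)

/-- All pairs of five points, with one triple at each of three of them. -/
def sunGadget : Gadget where
  size := 11
  triples := {{0, 5, 6}, {1, 7, 8}, {2, 9, 10}}
  pairs := {(0, 1), (0, 2), (0, 3), (0, 4), (1, 2), (1, 3), (1, 4), (2, 3), (2, 4), (3, 4), (0, 0), (1, 1), (2, 2), (3, 3), (4, 4), (5, 5), (6, 6), (7, 7), (8, 8), (9, 9), (10, 10)}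

lemma sunGadget_extra_even : sunGadget.Extra 0 36 :=
  pairCoverable_of_coverCheck (by norm_num)
    [(0, 5), (0, 6), (5, 6), (1, 7), (1, 8), (7, 8), (2, 9), (2, 10), (9, 10), (0, 1), (0, 2), (0, 3), (0, 4), (1, 2), (1, 3), (1, 4), (2, 3), (2, 4), (3, 4), (0, 0), (1, 1), (2, 2), (3, 3), (4, 4), (5, 5), (6, 6), (7, 7), (8, 8), (9, 9), (10, 10)]
    [[(0, 1), (12, 0), (0, 2), (13, 0), (1, 2), (2, 12), (12, 13), (13, 1), (1, 4), (4, 12), (2,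
     4), (4, 13)], [(1, 11), (11, 12), (3, 11), (11, 14), (1, 3), (3, 12), (12, 14), (14, 1),
     (12, 15), (15, 1)], [(2, 11), (11, 13), (13, 20), (20, 2), (2, 10), (10, 13), (10, 20)],
     [(1, 7), (7, 12), (12, 19), (19, 1), (7, 8), (18, 19), (19, 7), (7, 18), (8, 19)], [(2, 3),
     (3, 13), (13, 14), (14, 2), (13, 15), (15, 2), (14, 15), (15, 3), (2, 13), (3, 14)], [(0,
     3), (14, 0), (0, 4), (4, 11), (11, 15), (15, 0), (3, 4), (4, 14), (4, 15)], [(5, 11), (11,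
     16), (16, 0), (0, 11), (5, 16)], [(12, 18), (18, 1), (1, 8), (8, 12), (8, 18), (1, 12)],
     [(0, 5), (0, 6), (6, 11), (11, 17), (17, 0), (5, 6), (6, 16), (16, 17), (17, 5), (6, 17)],
     [(2, 9), (9, 13), (13, 21), (21, 2), (9, 10), (20, 21), (21, 9), (9, 20), (10, 21)]]
    (by unfold Gadget.Rel; decide +kernel) (by decide +kernel)

lemma sunGadget_extra_odd : sunGadget.Extra 1 42 :=
  pairCoverable_of_coverCheck (by norm_num)
    [(0, 5), (0, 6), (5, 6), (1, 7), (1, 8), (7, 8), (2, 9), (2, 10), (9, 10), (0, 1), (0, 2), (0, 3), (0, 4), (1, 2), (1, 3), (1, 4), (2, 3), (2, 4), (3, 4), (0, 0), (1, 1), (2, 2), (3, 3), (4, 4), (5, 5), (6, 6), (7, 7), (8, 8), (9, 9), (10, 10)]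
    [[(4, 11), (5, 11), (11, 16), (6, 11), (11, 17), (11, 22), (22, 4), (16, 22), (22, 5), (17,
     22), (22, 6)], [(7, 8), (8, 18), (18, 19), (19, 7), (7, 18), (18, 22), (22, 7), (8, 19),
     (19, 22), (22, 8)], [(9, 10), (10, 20), (20, 21), (21, 9), (9, 20), (20, 22), (22, 9), (10,
     21), (21, 22), (22, 10)], [(2, 3), (3, 13), (13, 15), (15, 2), (2, 9), (9, 13), (13, 20),
     (20, 2), (2, 10), (10, 13), (13, 21), (21, 2)], [(0, 1), (12, 0), (1, 7), (7, 12), (12, 18),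
     (18, 1), (1, 8), (8, 12), (12, 19), (19, 1), (1, 12)], [(1, 3), (3, 12), (1, 4), (4, 12),
     (12, 15), (15, 1), (3, 4), (12, 22), (22, 1), (22, 3), (4, 15), (15, 22)], [(1, 11), (11,
     12), (2, 11), (11, 13), (1, 2), (2, 12), (12, 13), (13, 1), (12, 14), (14, 1), (13, 14),
     (14, 2)], [(0, 3), (3, 11), (11, 14), (14, 0), (11, 15), (15, 0), (14, 15), (15, 3), (0,
     11), (3, 14)], [(0, 5), (16, 0), (0, 6), (17, 0), (5, 6), (6, 16), (16, 17), (17, 5), (5,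
     16), (6, 17)], [(0, 2), (13, 0), (0, 4), (2, 4), (4, 13), (4, 14), (22, 0), (2, 13), (13,
     22), (22, 2), (14, 22)]]
    (by unfold Gadget.Rel; decide +kernel) (by decide +kernel)

lemma PairArc.comm {n a b u v : ℕ} (h : PairArc n a b u v) : PairArc n b a u v := by
  rcases h with h | h | ⟨rfl, h⟩
  · exact Or.inr (Or.inl h)
  · exact Or.inl h
  · exact Or.inr (Or.inr ⟨rfl, h⟩)

lemma PairCoverable.symm {δ n A : ℕ} {R : Fin n → Fin n → Prop} (h : PairCoverable δ R A) :
    PairCoverable δ (fun a b => R a b ∨ R b a) A :=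
  Coverable.mono h (by
    rintro u v ⟨a, b, hab | hab, h⟩
    · exact ⟨a, b, hab, h⟩
    · exact ⟨b, a, hab, h.comm⟩) le_rfl

/-! ### From triple systems with embedded gadgets to the ring -/

lemma exists_equiv_lt_of_lt {P : Type*} [Fintype P] {n : ℕ} (hn : Fintype.card P = n)
    (w : P → ℕ) : ∃ e : P ≃ Fin n, ∀ p q, w p < w q → e p < e q := by
  let e₀ := Fintype.equivFinOfCardEq hn
  let σ := Tuple.sort (w ∘ e₀.symm)
  refine ⟨e₀.trans σ.symm, fun p q h => ?_⟩
  by_contra hcon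
  have := Tuple.monotone_sort (w ∘ e₀.symm) (not_lt.1 hcon)
  simp only [Function.comp_apply, Equiv.trans_apply] at this
  have hs : ∀ x, Tuple.sort (w ∘ e₀.symm) (σ.symm x) = x := fun x => σ.apply_symm_apply x
  rw [hs, hs, Equiv.symm_apply_apply, Equiv.symm_apply_apply] at this
  omega

/-- A triple system on `n` points in which point-disjoint gadgets are embedded, such that all pairs
of points are covered by a triple or by a gadget, yields a valid solution on the rings with `2 * n`
and `2 * n + 1` vertices. -/
theorem adm_le_of_design {P : Type*} [Fintype P] [DecidableEq P] {δ n : ℕ} (hδ : δ ≤ 1)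
    (hn : Fintype.card P = n) (B : Finset (Finset P)) (hB : ∀ b ∈ B, b.card = 3)
    {K : Type*} [Fintype K] (G : K → Gadget) (f : ∀ k, Fin (G k).size → P)
    (hinj : ∀ k, Function.Injective (f k)) (hdisj : ∀ k k' i j, f k i = f k' j → k = k')
    (hT : ∀ k, ∀ t ∈ (G k).triples, t.image (f k) ∈ B) (x : K → ℕ)
    (hx : ∀ k, (G k).Extra δ (x k))
    (hcover : ∀ p q, (p ≠ q ∧ ∃ b ∈ B, p ∈ b ∧ q ∈ b) ∨ ∃ k, ∃ i j, (i, j) ∈ (G k).pairs ∧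
      (f k i = p ∧ f k j = q ∨ f k i = q ∧ f k j = p)) :
    adm 3 (2 * n + δ) ≤ 6 * B.card + ∑ k, x k := by
  classical
  -- Gadget covers depend on the order of the points. Since the gadgets are point-disjoint, each
  -- point has at most one local index, and numbering all points by increasing local index makes
  -- every embedding monotone at once.
  obtain ⟨w, hw⟩ : ∃ w : P → ℕ, ∀ k i, w (f k i) = i.val := by
    have key : ∀ p, ∃ m : ℕ, ∀ k i, f k i = p → m = i.val := by
      intro p
      by_cases h : ∃ k, ∃ i, f k i = p
      · obtain ⟨k, i, rfl⟩ := h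
        refine ⟨i.val, fun k' i' h' => ?_⟩
        obtain rfl := hdisj _ _ _ _ h'
        rw [hinj _ h']
      · exact ⟨0, fun k i h' => absurd ⟨k, i, h'⟩ h⟩
    choose w hw using key
    exact ⟨w, fun k i => hw _ k i rfl⟩
  obtain ⟨e, he⟩ := exists_equiv_lt_of_lt hn w
  have hmono : ∀ k, StrictMono (e ∘ f k) := fun k i j hij =>
    he _ _ (by rw [hw, hw]; exact hij)
  let T : K → Finset (Finset P) := fun k => (G k).triples.image (image (f k))
  have hTcard : ∀ k, (T k).card = (G k).triples.card := fun k =>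
    card_image_of_injective _ (image_injective (hinj k))
  -- The triples absorbed by gadgets. They are distinct for different gadgets, so each triple is
  -- paid for with six vertices exactly once, inside a gadget or on its own.
  let Ex : Finset (Finset P) := univ.biUnion T
  have hEx : Ex ⊆ B := by
    intro b hb
    obtain ⟨k, -, hb⟩ := mem_biUnion.1 hb
    obtain ⟨t, ht, rfl⟩ := mem_image.1 hb
    exact hT k t ht
  have hExcard : Ex.card = ∑ k, (G k).triples.card := by
    rw [card_biUnion]
    · exact sum_congr rfl fun k _ => hTcard k
    · intro k _ k' _ hne
      rw [Function.onFun, disjoint_left]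
      intro b hb hb'
      have hb3 := hB b (hEx (mem_biUnion.2 ⟨k, mem_univ k, hb⟩))
      obtain ⟨p, hp⟩ : b.Nonempty := card_pos.1 (by omega)
      obtain ⟨t, ht, rfl⟩ := mem_image.1 hb
      obtain ⟨t', ht', h⟩ := mem_image.1 hb'
      obtain ⟨i, -, rfl⟩ := mem_image.1 hp
      rw [← h] at hp
      obtain ⟨j, -, hj⟩ := mem_image.1 hp
      exact hne (hdisj _ _ _ _ hj).symm
  have h1 := PairCoverable.bUnion (δ := δ) (n := n) (B \ Ex)
    (fun b p q => p ≠ q ∧ p ∈ b.image e ∧ q ∈ b.image e) (fun _ => 6) (fun b hb =>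
      pairCoverable_of_card_eq_three hδ (by
        rw [card_image_of_injective _ e.injective]
        exact hB b (mem_sdiff.1 hb).1))
  have h2 := PairCoverable.bUnion (δ := δ) (n := n) (univ : Finset K) _
    (fun k => 6 * (G k).triples.card + x k) (fun k _ => (hx k).map (hmono k) hδ)
  have hcard : 6 * (B \ Ex).card + ∑ k, (6 * (G k).triples.card + x k) =
      6 * B.card + ∑ k, x k := by
    have := card_le_card hEx
    rw [card_sdiff_of_subset hEx, sum_add_distrib, ← mul_sum, ← hExcard]
    omega
  refine adm_le_of_pairCoverable hδ ((h1.or h2).symm.mono ?_ ?_)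
  · intro a b _
    obtain ⟨p, rfl⟩ := e.surjective a
    obtain ⟨q, rfl⟩ := e.surjective b
    rcases hcover p q with ⟨hpq, c, hc, hp, hq⟩ | ⟨k, i, j, hij, ⟨rfl, rfl⟩ | ⟨rfl, rfl⟩⟩
    · refine Or.inl ?_
      by_cases hcE : c ∈ Ex
      · obtain ⟨k, -, hk⟩ := mem_biUnion.1 hcE
        obtain ⟨t, ht, rfl⟩ := mem_image.1 hk
        obtain ⟨i, hi, rfl⟩ := mem_image.1 hp
        obtain ⟨j, hj, rfl⟩ := mem_image.1 hq
        exact Or.inr ⟨k, mem_univ k, i, j,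
          Or.inl ⟨t, ht, fun h => hpq (congrArg _ h), hi, hj⟩, rfl, rfl⟩
      · exact Or.inl ⟨c, mem_sdiff.2 ⟨hc, hcE⟩, fun h => hpq (e.injective h),
          mem_image_of_mem _ hp, mem_image_of_mem _ hq⟩
    · exact Or.inl (Or.inr ⟨k, mem_univ k, i, j, Or.inr hij, rfl, rfl⟩)
    · exact Or.inr (Or.inr ⟨k, mem_univ k, i, j, Or.inr hij, rfl, rfl⟩)
  · rw [← hcard, sum_const, smul_eq_mul, mul_comm]

/-! ### Triples from commutative quasigroups on three copies of `ZMod m` -/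

/-- Three copies of the integers modulo `m`, and `r` further points. -/
abbrev Points (m r : ℕ) : Type := (ZMod m × Fin 3) ⊕ Fin r

/-- The point `x` of the copy `i`. -/
abbrev pt {m r : ℕ} (x : ZMod m) (i : Fin 3) : Points m r := Sum.inl (x, i)

lemma pt_inj {m r : ℕ} {x y : ZMod m} {i j : Fin 3} :
    (pt x i : Points m r) = pt y j ↔ x = y ∧ i = j := by
  simp [pt]

lemma card_points (m r : ℕ) [NeZero m] : Fintype.card (Points m r) = 3 * m + r := by
  simp [mul_comm]

/-- The triples that join two points `x`, `y` of one copy to the point `τ (x + y)` of the next. -/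
def latinTriples {m : ℕ} [NeZero m] (r : ℕ) (τ : Fin 3 → ZMod m → ZMod m) :
    Finset (Finset (Points m r)) :=
  (powersetCard 2 (univ : Finset (ZMod m)) ×ˢ (univ : Finset (Fin 3))).image fun s =>
    insert (pt (τ s.2 (∑ x ∈ s.1, x)) (s.2 + 1)) (s.1.image fun x => pt x s.2)

section Latin

variable {m r : ℕ} [NeZero m] {τ : Fin 3 → ZMod m → ZMod m}

lemma latinTriples_card_le : (latinTriples r τ).card ≤ 3 * m.choose 2 := by
  refine card_image_le.trans ?_
  rw [card_product, card_powersetCard, card_univ, card_univ, ZMod.card, Fintype.card_fin, mul_comm]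

lemma triple_mem_latinTriples {x y : ZMod m} (hxy : x ≠ y) (i : Fin 3) :
    {pt (τ i (x + y)) (i + 1), pt x i, pt y i} ∈ latinTriples r τ := by
  refine mem_image.2 ⟨({x, y}, i), mem_product.2 ⟨mem_powersetCard.2 ⟨subset_univ _,
    card_pair hxy⟩, mem_univ _⟩, ?_⟩
  simp only [sum_pair hxy, image_insert, image_singleton]

lemma card_of_mem_latinTriples : ∀ b ∈ latinTriples r τ, b.card = 3 := by
  intro b hb
  obtain ⟨⟨s, i⟩, hs, rfl⟩ := mem_image.1 hb
  have hs2 := (mem_powersetCard.1 (mem_product.1 hs).1).2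
  dsimp only at hs2 ⊢
  rw [card_insert_of_notMem, card_image_of_injective, hs2]
  · intro x y h
    exact (pt_inj.1 h).1
  · intro h
    obtain ⟨x, -, hx⟩ := mem_image.1 h
    exact absurd (pt_inj.1 hx).2 ((by decide : ∀ i : Fin 3, i ≠ i + 1) i)

/-- To join `x` to `y = τ i s` in the next copy, the partner of `x` must be `s - x`, which fails
only if it equals `x`. So the only pairs missed are those of `x` with `τ i (x + x)`. -/
lemma latinTriples_cover (hτ : ∀ i, Function.Surjective (τ i)) {x y : ZMod m} {i j : Fin 3}
    (hne : (x, i) ≠ (y, j)) :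
    (∃ b ∈ latinTriples r τ, pt x i ∈ b ∧ pt y j ∈ b) ∨ (j = i + 1 ∧ y = τ i (x + x)) ∨
      (i = j + 1 ∧ x = τ j (y + y)) := by
  have step : ∀ (x y : ZMod m) (i : Fin 3),
      (∃ b ∈ latinTriples r τ, pt x i ∈ b ∧ pt y (i + 1) ∈ b) ∨ y = τ i (x + x) := by
    intro x y i
    obtain ⟨s, rfl⟩ := hτ i y
    by_cases h : x = s - x
    · right
      rw [show x + x = s by linear_combination h]
    · left
      refine ⟨_, triple_mem_latinTriples h i, ?_, ?_⟩ <;> simp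
  have hij : i = j ∨ j = i + 1 ∨ i = j + 1 :=
    (by decide : ∀ i j : Fin 3, i = j ∨ j = i + 1 ∨ i = j + 1) i j
  rcases hij with rfl | rfl | rfl
  · left
    have hxy : x ≠ y := fun h => hne (by rw [h])
    refine ⟨_, triple_mem_latinTriples hxy i, ?_, ?_⟩ <;> simp
  · rcases step x y i with h | h
    · exact Or.inl h
    · exact Or.inr (Or.inl ⟨rfl, h⟩)
  · rcases step y x j with ⟨b, hb, h1, h2⟩ | h
    · exact Or.inl ⟨b, hb, h2, h1⟩
    · exact Or.inr (Or.inr ⟨rfl, h⟩)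

end Latin

/-- The triple that consists of the copies of `x`. -/
def column {m r : ℕ} (x : ZMod m) : Finset (Points m r) := {pt x 0, pt x 1, pt x 2}

lemma pt_mem_column {m r : ℕ} (x : ZMod m) (i : Fin 3) : (pt x i : Points m r) ∈ column x := by
  fin_cases i <;> simp [column]

lemma column_card {m r : ℕ} (x : ZMod m) : (column x : Finset (Points m r)).card = 3 := by
  rw [column, card_eq_three]
  exact ⟨_, _, _, by simp, by simp, by simp, rfl⟩

lemma image_pt_eq_column {m r : ℕ} (x : ZMod m) :
    ({0, 1, 2} : Finset (Fin 3)).image (fun i => (pt x i : Points m r)) = column x := by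
  simp [column, image_insert]

lemma diag_mem_triangleGadget : ∀ i : Fin 3, (i, i) ∈ triangleGadget.pairs :=
  (by decide : ∀ i : Fin 3, (i, i) ∈ ({(0, 0), (1, 1), (2, 2)} : Finset (Fin 3 × Fin 3)))

/-! ### The case n ≡ 3 mod 6: the Bose system -/

/-- Half of an integer modulo `2 * k + 1`. -/
def half {k : ℕ} (s : ZMod (2 * k + 1)) : ZMod (2 * k + 1) := s * (k + 1)

lemma half_add_self {k : ℕ} (x : ZMod (2 * k + 1)) : half (x + x) = x := by
  have h : ((2 * k + 1 : ℕ) : ZMod (2 * k + 1)) = 0 := ZMod.natCast_self _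
  push_cast at h
  unfold half
  linear_combination x * h

lemma half_surjective (k : ℕ) : Function.Surjective (half (k := k)) := fun x =>
  ⟨x + x, half_add_self x⟩

lemma choose_two_mul (m : ℕ) : 2 * m.choose 2 + m = m * m := by
  rw [Nat.choose_two_right, Nat.mul_div_cancel' (Nat.even_mul_pred_self m).two_dvd]
  cases m with
  | zero => rfl
  | succ m => rw [Nat.add_sub_cancel]; ring

/-- With `τ = half` the quasigroup is idempotent, so the missed pairs are those inside columns.
Adding the columns as triples completes the system, and these columns are disjoint triangle gadgets
covering every point. -/
lemma adm_le_three_mod_six {δ : ℕ} (hδ : δ ≤ 1) {x : ℕ} (hx : triangleGadget.Extra δ x) (k : ℕ) :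
    adm 3 (2 * (6 * k + 3) + δ) ≤ (6 * k + 3) * (6 * k + 2) + (2 * k + 1) * x := by
  let m := 2 * k + 1
  let B : Finset (Finset (Points m 0)) := latinTriples 0 (fun _ => half) ∪ univ.image column
  have hBcard : B.card ≤ 3 * m.choose 2 + m := by
    refine (card_union_le _ _).trans (Nat.add_le_add latinTriples_card_le ?_)
    exact card_image_le.trans (by rw [card_univ, ZMod.card])
  have hcard : Fintype.card (Points m 0) = 6 * k + 3 := by rw [card_points]; omega
  have hmain := adm_le_of_design hδ hcard B
    (by
      intro b hb
      rcases mem_union.1 hb with hb | hb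
      · exact card_of_mem_latinTriples b hb
      · obtain ⟨y, -, rfl⟩ := mem_image.1 hb
        exact column_card y)
    (K := ZMod m) (fun _ => triangleGadget) (fun y i => pt y i)
    (fun y i j h => (pt_inj.1 h).2) (fun y y' i j h => (pt_inj.1 h).1)
    (by
      intro y t ht
      obtain rfl := mem_singleton.1 ht
      refine mem_union_right _ (mem_image.2 ⟨y, mem_univ y, (image_pt_eq_column y).symm⟩))
    (fun _ => x) (fun _ => hx)
    (by
      rintro (⟨y, i⟩ | p) (⟨z, j⟩ | q)
      · by_cases h : (y, i) = (z, j)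
        · obtain ⟨rfl, rfl⟩ := Prod.mk.inj h
          exact Or.inr ⟨y, i, i, diag_mem_triangleGadget i, Or.inl ⟨rfl, rfl⟩⟩
        · refine Or.inl ⟨fun h' => h (Sum.inl_injective h'), ?_⟩
          have hcol : ∀ y : ZMod m, column y ∈ B := fun y =>
            mem_union_right _ (mem_image_of_mem _ (mem_univ y))
          rcases latinTriples_cover (r := 0) (fun _ => half_surjective k) h with
            ⟨b, hb, h'⟩ | ⟨-, h'⟩ | ⟨-, h'⟩
          · exact ⟨b, mem_union_left _ hb, h'⟩
          · rw [half_add_self] at h'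
            subst h'
            exact ⟨_, hcol z, pt_mem_column z i, pt_mem_column z j⟩
          · rw [half_add_self] at h'
            subst h'
            exact ⟨_, hcol y, pt_mem_column y i, pt_mem_column y j⟩
      · exact q.elim0
      · exact p.elim0
      · exact p.elim0)
  refine hmain.trans ?_
  rw [sum_const, card_univ, ZMod.card, smul_eq_mul]
  have := choose_two_mul m
  simp only [m] at *
  nlinarith

/-! ### The case n ≡ 1 mod 6: Skolem systems -/

/-- Reduces injectivity modulo `2 * k`, for values below `4 * k`, to linear arithmetic. -/
lemma natCast_zmod_eq {M a b : ℕ} (h : (a : ZMod M) = b) (ha : a < 2 * M) (hb : b < 2 * M) :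
    a = b ∨ a = b + M ∨ b = a + M := by
  rw [ZMod.natCast_eq_natCast_iff] at h
  rcases le_total a b with hab | hab
  · obtain ⟨c, hc⟩ := (Nat.modEq_iff_dvd' hab).1 h
    have : c < 2 := by
      by_contra hcon
      have := Nat.mul_le_mul_left M (not_lt.1 hcon)
      omega
    interval_cases c <;> omega
  · obtain ⟨c, hc⟩ := (Nat.modEq_iff_dvd' hab).1 h.symm
    have : c < 2 := by
      by_contra hcon
      have := Nat.mul_le_mul_left M (not_lt.1 hcon)
      omega
    interval_cases c <;> omega

lemma diag_mem_cycleGadget : ∀ i : Fin 6, (i, i) ∈ cycleGadget.pairs :=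
  (by decide : ∀ i : Fin 6, (i, i) ∈ ({(0, 0), (1, 1), (2, 2), (3, 3), (4, 4), (5, 5)} :
    Finset (Fin 6 × Fin 6)))

/-- The points of two columns in the order in which they form a cycle of triples. -/
def twoColumns {m r : ℕ} (u v : ZMod m) : Fin 6 → Points m r :=
  ![pt v 0, pt v 1, pt v 2, pt u 0, pt u 1, pt u 2]

lemma twoColumns_eq {m r : ℕ} (u v : ZMod m) (i : Fin 6) :
    ∃ j, (twoColumns u v i : Points m r) = pt u j ∨ (twoColumns u v i : Points m r) = pt v j := by
  fin_cases i
  exacts [⟨0, Or.inr rfl⟩, ⟨1, Or.inr rfl⟩, ⟨2, Or.inr rfl⟩, ⟨0, Or.inl rfl⟩, ⟨1, Or.inl rfl⟩,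
    ⟨2, Or.inl rfl⟩]

lemma twoColumns_surj {m r : ℕ} (u v : ZMod m) (j : Fin 3) :
    (∃ i, (twoColumns u v i : Points m r) = pt u j) ∧
      ∃ i, (twoColumns u v i : Points m r) = pt v j := by
  fin_cases j
  exacts [⟨⟨3, rfl⟩, 0, rfl⟩, ⟨⟨4, rfl⟩, 1, rfl⟩, ⟨⟨5, rfl⟩, 2, rfl⟩]

lemma twoColumns_injective {m r : ℕ} {u v : ZMod m} (h : u ≠ v) :
    Function.Injective (twoColumns u v : Fin 6 → Points m r) := by
  intro i j hij
  fin_cases i <;> fin_cases j <;> simp_all [twoColumns, h.symm]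

/-- If `τ (u + v) = v`, the triples on `u`, `v` in each copy close up: the `v`-points are the three
corners of the cycle and the `u`-points lie on its sides. -/
lemma image_twoColumns {m r : ℕ} [NeZero m] {τ : ZMod m → ZMod m} {u v : ZMod m} (h : u ≠ v)
    (hτ : τ (u + v) = v) :
    ∀ t ∈ ({{0, 1, 3}, {1, 2, 4}, {0, 2, 5}} : Finset (Finset (Fin 6))),
      t.image (twoColumns u v) ∈ latinTriples r (fun _ => τ) := by
  have key := fun i => triple_mem_latinTriples (r := r) (τ := fun _ => τ) h i
  simp only [hτ] at key
  intro t ht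
  simp only [mem_insert, mem_singleton] at ht
  rcases ht with rfl | rfl | rfl
  · convert key 0 using 1
    ext p
    simp [twoColumns]
    tauto
  · convert key 1 using 1
    ext p
    simp [twoColumns]
    tauto
  · convert key 2 using 1
    ext p
    simp [twoColumns]
    tauto

/-- The gadgets of a triple system with `t` pairs of columns, `s` single columns and one further
point. -/
def skolemGadget (t s : ℕ) : Fin t ⊕ Fin s ⊕ Unit → Gadget :=
  Sum.elim (fun _ => cycleGadget) (Sum.elim (fun _ => triangleGadget) fun _ => pointGadget)

/-- The points of the gadgets of `skolemGadget`. -/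
def skolemPoint {m t s : ℕ} (C : Fin t ⊕ Fin t ⊕ Fin s → ZMod m) :
    ∀ k, Fin (skolemGadget t s k).size → Points m 1
  | Sum.inl c => twoColumns (C (Sum.inl c)) (C (Sum.inr (Sum.inl c)))
  | Sum.inr (Sum.inl c) => fun i => pt (C (Sum.inr (Sum.inr c))) i
  | Sum.inr (Sum.inr _) => fun _ => Sum.inr 0

/-- Modulo `2 * k` doubling hits only even residues, and `j`, `j + k` have the same double. The
missed pairs at `j < k` form the column of `j`, which is added as a triple; those at `j + k` lead to
`j` in the next copy and are joined to the extra point. Only columns of `j < k` are triples, so the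
others must lie in cycle gadgets, each of which uses up two columns. `C` lists the columns: first
and second members of pairs, then single ones. -/
lemma adm_le_of_skolem {δ : ℕ} (hδ : δ ≤ 1) {xp xt xc : ℕ} (hp : pointGadget.Extra δ xp)
    (ht : triangleGadget.Extra δ xt) (hc : cycleGadget.Extra δ xc) {k : ℕ} (hk : 1 ≤ k)
    (τ : ZMod (2 * k) → ZMod (2 * k)) (hτ : Function.Surjective τ)
    (hlow : ∀ j : ℕ, j < k → τ (j + j) = j) {t s : ℕ} (C : Fin t ⊕ Fin t ⊕ Fin s → ZMod (2 * k))
    (hC : Function.Bijective C)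
    (hcyc : ∀ c, τ (C (Sum.inl c) + C (Sum.inr (Sum.inl c))) = C (Sum.inr (Sum.inl c)))
    (hcol : ∀ c, ∃ j : ℕ, j < k ∧ C (Sum.inr (Sum.inr c)) = j) :
    adm 3 (2 * (6 * k + 1) + δ) ≤ (6 * k + 1) * (6 * k) + (t * xc + (s * xt + xp)) := by
  have : NeZero (2 * k) := ⟨by omega⟩
  let inf : ℕ × Fin 3 → Finset (Points (2 * k) 1) := fun q =>
    {Sum.inr 0, pt ((q.1 + k : ℕ) : ZMod (2 * k)) q.2, pt (q.1 : ZMod (2 * k)) (q.2 + 1)}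
  let B : Finset (Finset (Points (2 * k) 1)) := latinTriples 1 (fun _ => τ) ∪
    ((range k).image (fun j : ℕ => column (j : ZMod (2 * k))) ∪ (range k ×ˢ univ).image inf)
  have hBcard : B.card ≤ 3 * (2 * k).choose 2 + (k + k * 3) := by
    refine (card_union_le _ _).trans (Nat.add_le_add latinTriples_card_le ?_)
    refine (card_union_le _ _).trans (Nat.add_le_add ?_ ?_)
    · exact card_image_le.trans (by rw [card_range])
    · exact card_image_le.trans (by rw [card_product, card_range, card_univ, Fintype.card_fin])
  have hBlatin : ∀ b ∈ latinTriples 1 (fun _ => τ), b ∈ B := fun b hb => mem_union_left _ hb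
  have hBcol : ∀ j < k, column (j : ZMod (2 * k)) ∈ B := fun j hj =>
    mem_union_right _ (mem_union_left _ (mem_image.2 ⟨j, mem_range.2 hj, rfl⟩))
  have hBinf : ∀ j < k, ∀ i, inf (j, i) ∈ B := fun j hj i =>
    mem_union_right _ (mem_union_right _ (mem_image.2
      ⟨(j, i), mem_product.2 ⟨mem_range.2 hj, mem_univ i⟩, rfl⟩))
  have hcases : ∀ x : ZMod (2 * k), ∃ j : ℕ, j < k ∧ (x = (j : ℕ) ∨ x = ((j + k : ℕ) : ZMod _)) := by
    intro x
    have hx := ZMod.natCast_zmod_val x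
    have hlt := ZMod.val_lt x
    rcases lt_or_ge x.val k with h | h
    · exact ⟨x.val, h, Or.inl hx.symm⟩
    · refine ⟨x.val - k, by omega, Or.inr ?_⟩
      rw [Nat.sub_add_cancel h, hx]
  have hzero : ((k : ℕ) : ZMod (2 * k)) + k = 0 := by
    have := ZMod.natCast_self (2 * k)
    push_cast at this
    linear_combination this
  have hleft : ∀ (x : ZMod (2 * k)) (i : Fin 3), ∃ b ∈ B, (pt x i : Points (2 * k) 1) ∈ b ∧
      pt (τ (x + x)) (i + 1) ∈ b := by
    intro x i
    obtain ⟨j, hj, rfl | rfl⟩ := hcases x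
    · rw [hlow j hj]
      exact ⟨_, hBcol j hj, pt_mem_column _ _, pt_mem_column _ _⟩
    · have : ((j + k : ℕ) : ZMod (2 * k)) + ((j + k : ℕ) : ZMod (2 * k)) = j + j := by
        push_cast
        linear_combination hzero
      rw [this, hlow j hj]
      exact ⟨_, hBinf j hj i, by simp [inf], by simp [inf]⟩
  have hinf : ∀ (x : ZMod (2 * k)) (i : Fin 3), ∃ b ∈ B, (pt x i : Points (2 * k) 1) ∈ b ∧
      Sum.inr 0 ∈ b := by
    intro x i
    obtain ⟨j, hj, rfl | rfl⟩ := hcases x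
    · refine ⟨_, hBinf j hj (i + 2), ?_, by simp [inf]⟩
      -- A point of the lower half meets the extra point as the end of a missed pair starting in the
      -- previous copy, which is `i + 2`.
      have : i + 2 + 1 = i := (by decide : ∀ i : Fin 3, i + 2 + 1 = i) i
      simp [inf, this]
    · exact ⟨_, hBinf j hj i, by simp [inf], by simp [inf]⟩
  have huv : ∀ c, C (Sum.inl c) ≠ C (Sum.inr (Sum.inl c)) := fun c h => by
    simpa using hC.1 h
  have hcard : Fintype.card (Points (2 * k) 1) = 6 * k + 1 := by rw [card_points]; omega
  have hmain := adm_le_of_design hδ hcard B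
    (by
      intro b hb
      rcases mem_union.1 hb with hb | hb
      · exact card_of_mem_latinTriples b hb
      rcases mem_union.1 hb with hb | hb
      · obtain ⟨y, -, rfl⟩ := mem_image.1 hb
        exact column_card _
      · obtain ⟨⟨j, i⟩, -, rfl⟩ := mem_image.1 hb
        refine card_eq_three.2 ⟨_, _, _, by simp, by simp, ?_, rfl⟩
        exact fun h => absurd (pt_inj.1 h).2 ((by decide : ∀ i : Fin 3, i ≠ i + 1) i))
    (skolemGadget t s) (skolemPoint C)
    (by
      rintro (c | c | c)
      · exact twoColumns_injective (huv c)
      · exact fun i j h => (pt_inj.1 h).2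
      · exact fun i j _ => Subsingleton.elim (α := Fin 1) i j)
    (by
      have h1 : ∀ c i, ∃ j, skolemPoint C (Sum.inl c) i = pt (C (Sum.inl c)) j ∨
          skolemPoint C (Sum.inl c) i = pt (C (Sum.inr (Sum.inl c))) j := fun c i =>
        twoColumns_eq _ _ i
      rintro (c | c | c) (c' | c' | c') i j h
      · obtain ⟨i', hi⟩ := h1 c i
        obtain ⟨j', hj⟩ := h1 c' j
        rcases hi with hi | hi <;> rcases hj with hj | hj <;> rw [hi, hj, pt_inj] at h <;>
          simpa using hC.1 h.1
      · obtain ⟨i', hi⟩ := h1 c i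
        rcases hi with hi | hi <;> rw [hi] at h <;> simpa using hC.1 (pt_inj.1 h).1
      · obtain ⟨i', hi⟩ := h1 c i
        rcases hi with hi | hi <;> rw [hi] at h <;> cases h
      · obtain ⟨j', hj⟩ := h1 c' j
        rcases hj with hj | hj <;> rw [hj] at h <;> simpa using hC.1 (pt_inj.1 h).1
      · simpa using hC.1 (pt_inj.1 h).1
      · cases h
      · obtain ⟨j', hj⟩ := h1 c' j
        rcases hj with hj | hj <;> rw [hj] at h <;> cases h
      · cases h
      · rfl)
    (by
      rintro (c | c | c) t' ht'
      · exact hBlatin _ (image_twoColumns (huv c) (hcyc c) t' ht')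
      · obtain rfl := mem_singleton.1 ht'
        obtain ⟨j, hj, hjc⟩ := hcol c
        have := hBcol j hj
        rw [← hjc, ← image_pt_eq_column] at this
        exact this
      · exact absurd ht' (notMem_empty _))
    (Sum.elim (fun _ => xc) (Sum.elim (fun _ => xt) fun _ => xp))
    (by
      rintro (c | c | c)
      exacts [hc, ht, hp])
    (by
      have hdiag : ∀ (y : ZMod (2 * k)) (i : Fin 3), ∃ k' j, (j, j) ∈ (skolemGadget t s k').pairs ∧
          skolemPoint C k' j = pt y i := by
        intro y i
        obtain ⟨c | c | c, rfl⟩ := hC.2 y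
        · obtain ⟨⟨j, hj⟩, -⟩ := twoColumns_surj (r := 1) (C (Sum.inl c)) (C (Sum.inr (Sum.inl c))) i
          exact ⟨Sum.inl c, j, diag_mem_cycleGadget j, hj⟩
        · obtain ⟨-, ⟨j, hj⟩⟩ := twoColumns_surj (r := 1) (C (Sum.inl c)) (C (Sum.inr (Sum.inl c))) i
          exact ⟨Sum.inl c, j, diag_mem_cycleGadget j, hj⟩
        · exact ⟨Sum.inr (Sum.inl c), i, diag_mem_triangleGadget i, rfl⟩
      rintro (⟨y, i⟩ | p) (⟨z, j⟩ | q)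
      · by_cases h : (y, i) = (z, j)
        · obtain ⟨rfl, rfl⟩ := Prod.mk.inj h
          obtain ⟨k', j, hj, hj'⟩ := hdiag y i
          exact Or.inr ⟨k', j, j, hj, Or.inl ⟨hj', hj'⟩⟩
        · refine Or.inl ⟨fun h' => h (Sum.inl_injective h'), ?_⟩
          rcases latinTriples_cover (r := 1) (fun _ => hτ) h with
            ⟨b, hb, h'⟩ | ⟨rfl, rfl⟩ | ⟨rfl, rfl⟩
          · exact ⟨b, hBlatin b hb, h'⟩
          · exact hleft y i
          · obtain ⟨b, hb, h1, h2⟩ := hleft z j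
            exact ⟨b, hb, h2, h1⟩
      · obtain ⟨b, hb, h1, h2⟩ := hinf y i
        obtain rfl := Subsingleton.elim q 0
        exact Or.inl ⟨by simp, b, hb, h1, h2⟩
      · obtain ⟨b, hb, h1, h2⟩ := hinf z j
        obtain rfl := Subsingleton.elim p 0
        exact Or.inl ⟨by simp, b, hb, h2, h1⟩
      · obtain rfl := Subsingleton.elim p 0
        obtain rfl := Subsingleton.elim q 0
        exact Or.inr ⟨Sum.inr (Sum.inr ()), (0 : Fin 1), (0 : Fin 1),
          mem_singleton_self _, Or.inl ⟨rfl, rfl⟩⟩)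
  refine hmain.trans ?_
  have hsum : ∑ k', (Sum.elim (fun _ => xc) (Sum.elim (fun _ => xt) fun _ => xp) :
      Fin t ⊕ Fin s ⊕ Unit → ℕ) k' = t * xc + (s * xt + xp) := by
    simp [Fintype.sum_sum_type]
  rw [hsum]
  have := choose_two_mul (2 * k)
  nlinarith

/-- `ρ` is the inverse of `τ`, lifted to natural numbers. Thus `τ (u + v) = v` becomes the equality
`ρ v = u + v` in ℕ, with no reduction modulo `2 * k`. -/
lemma adm_le_of_skolem_nat {δ : ℕ} (hδ : δ ≤ 1) {xp xt xc : ℕ} (hp : pointGadget.Extra δ xp)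
    (ht : triangleGadget.Extra δ xt) (hc : cycleGadget.Extra δ xc) {k : ℕ} (hk : 1 ≤ k)
    (ρ : ℕ → ℕ) (hρ : ∀ a < 2 * k, ρ a < 2 * (2 * k))
    (hinj : ∀ a < 2 * k, ∀ b < 2 * k,
      ρ a = ρ b ∨ ρ a = ρ b + 2 * k ∨ ρ b = ρ a + 2 * k → a = b)
    (hlow : ∀ j < k, ρ j = j + j) {t s : ℕ} (hts : t + (t + s) = 2 * k)
    (D : Fin t ⊕ Fin t ⊕ Fin s → ℕ) (hD : Function.Injective D) (hDlt : ∀ c, D c < 2 * k)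
    (hcyc : ∀ c, ρ (D (Sum.inr (Sum.inl c))) = D (Sum.inl c) + D (Sum.inr (Sum.inl c)))
    (hcol : ∀ c, D (Sum.inr (Sum.inr c)) < k) :
    adm 3 (2 * (6 * k + 1) + δ) ≤ (6 * k + 1) * (6 * k) + (t * xc + (s * xt + xp)) := by
  have : NeZero (2 * k) := ⟨by omega⟩
  let σ : ZMod (2 * k) → ZMod (2 * k) := fun y => (ρ y.val : ℕ)
  have hσ : Function.Injective σ := fun y z h => ZMod.val_injective _
    (hinj _ (ZMod.val_lt y) _ (ZMod.val_lt z) (natCast_zmod_eq h (hρ _ (ZMod.val_lt y))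
      (hρ _ (ZMod.val_lt z))))
  let e : ZMod (2 * k) ≃ ZMod (2 * k) :=
    Equiv.ofBijective σ (Finite.injective_iff_bijective.1 hσ)
  have he : ∀ a < 2 * k, e.symm ((ρ a : ℕ) : ZMod (2 * k)) = (a : ℕ) := by
    intro a ha
    rw [Equiv.symm_apply_eq]
    change _ = ((ρ (a : ZMod (2 * k)).val : ℕ) : ZMod (2 * k))
    rw [ZMod.val_cast_of_lt ha]
  refine adm_le_of_skolem hδ hp ht hc hk e.symm e.symm.surjective (fun j hj => ?_)
    (fun c => (D c : ZMod (2 * k))) ?_ (fun c => ?_) fun c => ⟨_, hcol c, rfl⟩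
  · have h := he j (by omega)
    rw [hlow j hj] at h
    push_cast at h
    exact h
  · rw [Fintype.bijective_iff_injective_and_card]
    refine ⟨fun c d h => hD ?_, ?_⟩
    · have := congrArg ZMod.val h
      rwa [ZMod.val_cast_of_lt (hDlt c), ZMod.val_cast_of_lt (hDlt d)] at this
    · simp only [Fintype.card_sum, Fintype.card_fin, ZMod.card]
      exact hts
  · rw [← Nat.cast_add, ← hcyc c, he _ (hDlt _)]

/-- `ρ` is prescribed on `j < k`, where it takes the even residues; its values on the upper half may
be the odd residues in any order. They are chosen so that the columns split into pairs `u`, `v` with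
`ρ v = u + v`, up to two columns of the lower half when `k` is even. -/
lemma adm_le_one_mod_six {δ : ℕ} (hδ : δ ≤ 1) {x : ℕ} (hp : pointGadget.Extra δ (2 + δ))
    (ht : triangleGadget.Extra δ x) (hc : cycleGadget.Extra δ (2 * x)) (k : ℕ) :
    adm 3 (2 * (6 * k + 1) + δ) ≤ (6 * k + 1) * (6 * k) + (2 * k * x + (2 + δ)) := by
  rcases Nat.eq_zero_or_pos k with rfl | hk
  -- For `k = 0` there is one point and no triple.
  · have := adm_le_of_design (P := Unit) (n := 1) hδ (by simp) ∅ (by simp) (K := Unit)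
      (fun _ => pointGadget) (fun _ _ => ()) (fun _ i j _ => Subsingleton.elim (α := Fin 1) i j)
      (fun _ _ _ _ _ => rfl) (fun _ t ht => absurd ht (notMem_empty t)) (fun _ => 2 + δ)
      (fun _ => hp)
      (fun _ _ => Or.inr ⟨(), (0 : Fin 1), (0 : Fin 1), mem_singleton_self _, Or.inl ⟨rfl, rfl⟩⟩)
    simpa using this
  rcases Nat.even_or_odd' k with ⟨q, hq | hq⟩
  -- For `k` even, `u = c` and `v = c + k + 1` with `c < k - 2` produce the odd sums from k + 1 to
  -- 3k - 5. The further pair `k`, `2 * k - 1` has sum 3k - 1, and 3k - 3 is left as the value at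
  -- `k`. The columns `k - 2` and `k - 1` stay single.
  · refine (adm_le_of_skolem_nat hδ hp ht hc hk
      (fun y => if y < k then y + y else if y = k then 3 * k - 3
        else if y = 2 * k - 1 then 3 * k - 1 else 2 * y - k - 1) ?_ ?_ ?_ (t := k - 1) (s := 2)
      (by omega) (Sum.elim (fun c => if c.val < k - 2 then c.val else k)
        (Sum.elim (fun c => c.val + k + 1) fun c => k - 2 + c.val)) ?_ ?_ ?_ ?_).trans ?_
    · intro a ha
      split_ifs <;> omega
    · intro a ha b hb
      split_ifs <;> omega
    · intro j hj
      simp [hj]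
    · rintro (c | c | c) (d | d | d) h <;> have := c.isLt <;> have := d.isLt <;>
        simp only [Sum.elim_inl, Sum.elim_inr] at h <;> (try split_ifs at h) <;>
        first | omega | (obtain rfl : c = d := Fin.ext (by omega); rfl)
    · rintro (c | c | c) <;> have := c.isLt <;> simp only [Sum.elim_inl, Sum.elim_inr] <;>
        (try split_ifs) <;> omega
    · intro c
      have := c.isLt
      change (if c.val + k + 1 < k then (c.val + k + 1) + (c.val + k + 1)
        else if c.val + k + 1 = k then 3 * k - 3
        else if c.val + k + 1 = 2 * k - 1 then 3 * k - 1 else 2 * (c.val + k + 1) - k - 1) =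
        (if c.val < k - 2 then c.val else k) + (c.val + k + 1)
      split_ifs <;> omega
    · intro c
      have := c.isLt
      simp only [Sum.elim_inr]
      omega
    · obtain ⟨j, rfl⟩ : ∃ j, k = j + 1 := ⟨k - 1, by omega⟩
      rw [Nat.add_sub_cancel]
      nlinarith
  -- For `k` odd, `c` and `c + k` have the sums k, k + 2, …, 3k - 2, which are all the odd residues;
  -- no column is left over.
  · refine (adm_le_of_skolem_nat hδ hp ht hc hk
      (fun y => if y < k then y + y else 2 * y - k) ?_ ?_ ?_ (t := k) (s := 0)
      (by omega) (Sum.elim (fun c => c.val)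
        (Sum.elim (fun c => c.val + k) fun c => c.elim0)) ?_ ?_ ?_ ?_).trans ?_
    · intro a ha
      split_ifs <;> omega
    · intro a ha b hb
      split_ifs <;> omega
    · intro j hj
      simp [hj]
    · rintro (c | c | c) (d | d | d) h <;> (try exact c.elim0) <;> (try exact d.elim0) <;>
        have := c.isLt <;> have := d.isLt <;>
        simp only [Sum.elim_inl, Sum.elim_inr] at h <;>
        first | omega | (obtain rfl : c = d := Fin.ext (by omega); rfl)
    · rintro (c | c | c) <;> (try exact c.elim0) <;> have := c.isLt <;>
        simp only [Sum.elim_inl, Sum.elim_inr] <;> omega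
    · intro c
      have := c.isLt
      change (if c.val + k < k then (c.val + k) + (c.val + k) else 2 * (c.val + k) - k) =
        c.val + (c.val + k)
      split_ifs <;> omega
    · exact fun c => c.elim0
    · rw [zero_mul, zero_add]
      exact le_of_eq (by ring)

/-! ### The case n ≡ 5 mod 6: a triple system with a hole of five points -/

lemma diag_mem_sunGadget : ∀ i : Fin 11, (i, i) ∈ sunGadget.pairs :=
  (by decide : ∀ i : Fin 11, (i, i) ∈ ({(0, 1), (0, 2), (0, 3), (0, 4), (1, 2), (1, 3), (1, 4),
    (2, 3), (2, 4), (3, 4), (0, 0), (1, 1), (2, 2), (3, 3), (4, 4), (5, 5), (6, 6), (7, 7), (8, 8),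
    (9, 9), (10, 10)} : Finset (Fin 11 × Fin 11)))

lemma core_mem_sunGadget : ∀ i j : Fin 11, i < j → j < 5 → (i, j) ∈ sunGadget.pairs :=
  (by decide : ∀ i j : Fin 11, i < j → j < 5 → (i, j) ∈ ({(0, 1), (0, 2), (0, 3), (0, 4), (1, 2),
    (1, 3), (1, 4), (2, 3), (2, 4), (3, 4), (0, 0), (1, 1), (2, 2), (3, 3), (4, 4), (5, 5), (6, 6),
    (7, 7), (8, 8), (9, 9), (10, 10)} : Finset (Fin 11 × Fin 11)))

section FiveModSix

variable {k : ℕ}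

/-- Half, with a change of sign between the last copy and the first. -/
def twistedHalf (i : Fin 3) (s : ZMod (2 * k + 1)) : ZMod (2 * k + 1) :=
  if i = 2 then -half s else half s

lemma twistedHalf_surjective (i : Fin 3) : Function.Surjective (twistedHalf (k := k) i) := by
  intro x
  unfold twistedHalf
  split_ifs
  · exact ⟨-x + -x, by rw [half_add_self, neg_neg]⟩
  · exact ⟨x + x, half_add_self x⟩

/-- The further point that is joined to the point `x` of the copy `i` and its double's half in the
next copy. -/
def hexPole (x : ZMod (2 * k + 1)) (i : Fin 3) : Fin 2 := if (x.val ≤ k ↔ i ≠ 1) then 0 else 1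

/-- The triples that decompose the hexagons formed by the columns `x`, `-x`, joined to two further
points. -/
def hexTriple (q : ZMod (2 * k + 1) × Fin 3) : Finset (Points (2 * k + 1) 2) :=
  {pt q.1 q.2, pt (twistedHalf q.2 (q.1 + q.1)) (q.2 + 1), Sum.inr (hexPole q.1 q.2)}

/-- A triple system on `6 * k + 5` points that covers all pairs but those of five points. -/
def fiveTriples (k : ℕ) : Finset (Finset (Points (2 * k + 1) 2)) :=
  latinTriples 2 twistedHalf ∪ ((univ.filter (· ≠ 0)) ×ˢ univ).image hexTriple

lemma latin_mem_fiveTriples {b : Finset (Points (2 * k + 1) 2)}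
    (hb : b ∈ latinTriples 2 twistedHalf) : b ∈ fiveTriples k := mem_union_left _ hb

lemma hexTriple_mem_fiveTriples {x : ZMod (2 * k + 1)} (hx : x ≠ 0) (i : Fin 3) :
    hexTriple (x, i) ∈ fiveTriples k :=
  mem_union_right _ (mem_image_of_mem _ (mem_product.2 ⟨mem_filter.2 ⟨mem_univ x, hx⟩,
    mem_univ i⟩))

lemma fiveTriples_card_le : (fiveTriples k).card ≤ 3 * (2 * k + 1).choose 2 + 2 * k * 3 := by
  refine (card_union_le _ _).trans (Nat.add_le_add latinTriples_card_le ?_)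
  refine card_image_le.trans ?_
  rw [card_product, filter_ne', card_erase_of_mem (mem_univ _), card_univ, card_univ, ZMod.card,
    Fintype.card_fin, Nat.add_sub_cancel]

lemma card_of_mem_fiveTriples : ∀ b ∈ fiveTriples k, b.card = 3 := by
  intro b hb
  rcases mem_union.1 hb with hb | hb
  · exact card_of_mem_latinTriples b hb
  · obtain ⟨⟨x, i⟩, -, rfl⟩ := mem_image.1 hb
    refine card_eq_three.2 ⟨_, _, _, ?_, by simp, by simp, rfl⟩
    exact fun h => absurd (pt_inj.1 h).2 ((by decide : ∀ i : Fin 3, i ≠ i + 1) i)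

/-- Negation exchanges the nonzero residues up to `k` with those above, so `hexPole` changes its
value between the copies 2 and 0 of a hexagon too. -/
lemma val_neg_le_iff {x : ZMod (2 * k + 1)} (hx : x ≠ 0) : (-x).val ≤ k ↔ ¬ x.val ≤ k := by
  have h0 : x.val ≠ 0 := fun h => hx ((ZMod.val_eq_zero x).1 h)
  have := ZMod.val_lt x
  rw [ZMod.neg_val, if_neg hx]
  omega

/-- Because of the sign, the missed pairs at `x ≠ 0` form the hexagon through the columns of `x` and
`-x` instead of two triangles. Its edges go alternately to the two poles, so each vertex meets one
pole through each of its two edges. At zero the missed pairs form a triangle, which together with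
the poles is the hole. -/
lemma fiveTriples_cover_pole {x : ZMod (2 * k + 1)} (hx : x ≠ 0) (i : Fin 3) (c : Fin 2) :
    ∃ b ∈ fiveTriples k, pt x i ∈ b ∧ Sum.inr c ∈ b := by
  by_cases hc : c = hexPole x i
  · exact ⟨_, hexTriple_mem_fiveTriples hx i, by simp [hexTriple], by simp [hexTriple, hc]⟩
  · have hneg : -x ≠ 0 := neg_ne_zero.2 hx
    have hs := val_neg_le_iff hx
    have hd : half (-x + -x) = -x := half_add_self _
    -- The other edge at the point comes from the previous copy; for copy 0 it starts at `-x` in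
    -- copy 2.
    fin_cases i
    · refine ⟨_, hexTriple_mem_fiveTriples hneg 2, ?_, ?_⟩
      · simp [hexTriple, twistedHalf, hd]
      · have : c = hexPole (-x) 2 := by
          simp only [hexPole, hs] at hc ⊢
          revert hc
          by_cases h : x.val ≤ k <;> simp [h] <;> omega
        simp [hexTriple, this]
    · refine ⟨_, hexTriple_mem_fiveTriples hx 0, ?_, ?_⟩
      · simp [hexTriple, twistedHalf, half_add_self]
      · have : c = hexPole x 0 := by
          simp only [hexPole] at hc ⊢
          revert hc
          by_cases h : x.val ≤ k <;> simp [h] <;> omega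
        simp [hexTriple, this]
    · refine ⟨_, hexTriple_mem_fiveTriples hx 1, ?_, ?_⟩
      · simp [hexTriple, twistedHalf, half_add_self]
      · have : c = hexPole x 1 := by
          simp only [hexPole] at hc ⊢
          revert hc
          by_cases h : x.val ≤ k <;> simp [h] <;> omega
        simp [hexTriple, this]

end FiveModSix

lemma intCast_zmod_inj {k : ℕ} {a b : ℤ} (h : (a : ZMod (2 * k + 1)) = b)
    (hab : |a - b| < 2 * k + 1) : a = b := by
  rw [eq_comm, ZMod.intCast_eq_intCast_iff_dvd_sub] at h
  have := Int.eq_zero_of_abs_lt_dvd h (by push_cast; exact hab)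
  omega

/-! ### Disjoint triples in the system with a hole -/

/-- The points of the three triples at `w`, for the columns with a gap of `t i` at zero and a
block of `2 * p i` consecutive pairs. -/
def trianglePos (k : ℕ) (t p : Fin 3 → ℕ) (i : Fin 3) (w : ℕ) : Fin 3 → ℕ × Fin 3 :=
  ![(t i + w, i), (2 * k + 2 - t i - 2 * p i + w, i),
    (if i = 2 then k + p i - w else k + 1 - p i + w, i + 1)]

section TrianglePos

variable {k : ℕ} {t p : Fin 3 → ℕ}

/-- The relation `hrel` says that in copy `i + 1` the interval from `t` to `2 * k + 1 - t` is tiled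
by three consecutive blocks: first points, a central block of length `2 * p i` centred at `k + 1 /
2`, and second points. The central block receives the third points of the triples that start in copy
`i`; as it is symmetric under negation, the sign in `twistedHalf` merely reverses it. -/
lemma trianglePos_bounds (ht : ∀ i, 1 ≤ t i) (hrel : ∀ i, t (i + 1) + 2 * p (i + 1) + p i = k + 1)
    (i : Fin 3) (w : ℕ) (hw : w < 2 * p i) (r : Fin 3) :
    t (trianglePos k t p i w r).2 ≤ (trianglePos k t p i w r).1 ∧
      (trianglePos k t p i w r).1 + t (trianglePos k t p i w r).2 ≤ 2 * k + 1 := by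
  have h1 := hrel i
  have h2 := hrel (i + 2)
  rw [(by decide : ∀ i : Fin 3, i + 2 + 1 = i) i] at h2
  have := ht i
  have := ht (i + 1)
  fin_cases r
  · change t i ≤ t i + w ∧ t i + w + t i ≤ 2 * k + 1
    omega
  · change t i ≤ 2 * k + 2 - t i - 2 * p i + w ∧ 2 * k + 2 - t i - 2 * p i + w + t i ≤ 2 * k + 1
    omega
  · change t (i + 1) ≤ (if i = 2 then k + p i - w else k + 1 - p i + w) ∧
      (if i = 2 then k + p i - w else k + 1 - p i + w) + t (i + 1) ≤ 2 * k + 1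
    split_ifs <;> omega

lemma trianglePos_inj (ht : ∀ i, 1 ≤ t i) (hrel : ∀ i, t (i + 1) + 2 * p (i + 1) + p i = k + 1)
    {i i' : Fin 3} {w w' : ℕ} (hw : w < 2 * p i) (hw' : w' < 2 * p i') {r r' : Fin 3}
    (h : trianglePos k t p i w r = trianglePos k t p i' w' r') : i = i' ∧ w = w' ∧ r = r' := by
  have hval := congrArg Prod.fst h
  have hlev := congrArg Prod.snd h
  have hpre : ∀ i, t i + 2 * p i + p (i + 2) = k + 1 := fun i => by
    have h2 := hrel (i + 2)
    rwa [(by decide : ∀ i : Fin 3, i + 2 + 1 = i) i] at h2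
  have h1 := hrel i
  have h2 := hrel i'
  have h3 := hpre i
  have h4 := hpre i'
  have h5 := ht i
  have h6 := ht i'
  fin_cases r <;> fin_cases r' <;>
    simp only [trianglePos, Fin.zero_eta, Fin.mk_one, Fin.reduceFinMk, Matrix.cons_val] at hval hlev
  · subst hlev
    exact ⟨rfl, by omega, rfl⟩
  · subst hlev
    omega
  · subst hlev
    split_ifs at hval <;> omega
  · subst hlev
    omega
  · subst hlev
    exact ⟨rfl, by omega, rfl⟩
  · subst hlev
    split_ifs at hval <;> omega
  · subst hlev
    split_ifs at hval <;> omega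
  · subst hlev
    split_ifs at hval <;> omega
  · obtain rfl := add_right_cancel hlev
    refine ⟨rfl, ?_, rfl⟩
    split_ifs at hval <;> omega

lemma exists_trianglePos (hrel : ∀ i, t (i + 1) + 2 * p (i + 1) + p i = k + 1) {v : ℕ} {i : Fin 3}
    (h1 : t i ≤ v) (h2 : v + t i ≤ 2 * k + 1) :
    ∃ i', ∃ w < 2 * p i', ∃ r, trianglePos k t p i' w r = (v, i) := by
  obtain ⟨j, rfl⟩ : ∃ j, i = j + 1 := ⟨i + 2, (by decide : ∀ i : Fin 3, i = i + 2 + 1) i⟩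
  have h3 := hrel j
  rcases lt_or_ge v (k + 1 - p j) with h | h
  · refine ⟨j + 1, v - t (j + 1), by omega, 0, Prod.ext ?_ rfl⟩
    change t (j + 1) + (v - t (j + 1)) = v
    omega
  rcases lt_or_ge v (k + 1 + p j) with h' | h'
  · by_cases hj : j = 2
    · refine ⟨j, k + p j - v, by omega, 2, Prod.ext ?_ rfl⟩
      change (if j = 2 then k + p j - (k + p j - v) else _) = v
      rw [if_pos hj]
      omega
    · refine ⟨j, v - (k + 1 - p j), by omega, 2, Prod.ext ?_ rfl⟩
      change (if j = 2 then _ else k + 1 - p j + (v - (k + 1 - p j))) = v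
      rw [if_neg hj]
      omega
  · refine ⟨j + 1, v - (k + 1 + p j), by omega, 1, Prod.ext ?_ rfl⟩
    change 2 * k + 2 - t (j + 1) - 2 * p (j + 1) + (v - (k + 1 + p j)) = v
    omega

/-- The two points in copy `i` sum to twice `k + 1 - p i + w`, so the third point runs once through
the central block of the next copy. -/
lemma image_trianglePos_mem (ht : ∀ i, 1 ≤ t i)
    (hrel : ∀ i, t (i + 1) + 2 * p (i + 1) + p i = k + 1) (i : Fin 3) {w : ℕ} (hw : w < 2 * p i) :
    ({0, 1, 2} : Finset (Fin 3)).image (fun r =>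
      (pt ((trianglePos k t p i w r).1 : ZMod (2 * k + 1)) (trianglePos k t p i w r).2 :
        Points (2 * k + 1) 2)) ∈ fiveTriples k := by
  have h2 := hrel (i + 2)
  rw [(by decide : ∀ i : Fin 3, i + 2 + 1 = i) i] at h2
  have h3 := hrel i
  have h4 := ht i
  have hm : ((2 * k + 1 : ℕ) : ZMod (2 * k + 1)) = 0 := ZMod.natCast_self _
  have hne : ((t i + w : ℕ) : ZMod (2 * k + 1)) ≠ (2 * k + 2 - t i - 2 * p i + w : ℕ) := by
    intro h
    have := congrArg ZMod.val h
    rw [ZMod.val_cast_of_lt (by omega), ZMod.val_cast_of_lt (by omega)] at this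
    omega
  have hsum : ((t i + w : ℕ) : ZMod (2 * k + 1)) +
      ((2 * k + 2 - t i - 2 * p i + w : ℕ) : ZMod (2 * k + 1)) =
      ((k + 1 - p i + w : ℕ) : ZMod (2 * k + 1)) + ((k + 1 - p i + w : ℕ) : ZMod (2 * k + 1)) := by
    rw [← Nat.cast_add, ← Nat.cast_add]
    congr 1
    omega
  have hhalf : twistedHalf i (((t i + w : ℕ) : ZMod (2 * k + 1)) +
      ((2 * k + 2 - t i - 2 * p i + w : ℕ) : ZMod (2 * k + 1))) =
      ((if i = 2 then k + p i - w else k + 1 - p i + w : ℕ) : ZMod (2 * k + 1)) := by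
    unfold twistedHalf
    rw [hsum, half_add_self]
    split_ifs
    · rw [neg_eq_iff_add_eq_zero, ← Nat.cast_add, ← hm]
      congr 1
      omega
    · rfl
  have hmem := triple_mem_latinTriples (r := 2) (τ := twistedHalf) hne i
  rw [hhalf] at hmem
  have := latin_mem_fiveTriples hmem
  convert this using 1
  rw [image_insert, image_insert, image_singleton]
  ext q
  simp only [mem_insert, mem_singleton, trianglePos, Matrix.cons_val]
  tauto

end TrianglePos

/-! ### Assembling the sun and the disjoint triples -/

/-- The point of the system on `6 * k + 5` points with integral coordinates. -/
def intPoint (k : ℕ) : (ℤ × Fin 3) ⊕ Fin 2 → Points (2 * k + 1) 2 :=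
  Sum.map (Prod.map Int.cast id) id

/-- The sun takes the two poles and the points of copy `i` with `|a| < t i`. Those are `2 * t i - 1`
per copy, hence eleven points in all when the `t i` add up to six. Its first five points are the
hole; the tiled intervals supply `2 * k - 2` disjoint triangle gadgets for everything else. -/
theorem adm_le_of_sun {δ : ℕ} (hδ : δ ≤ 1) {xs xt : ℕ} (hs : sunGadget.Extra δ xs)
    (htri : triangleGadget.Extra δ xt) {k : ℕ} {t p : Fin 3 → ℕ} (ht : ∀ i, 1 ≤ t i)
    (hrel : ∀ i, t (i + 1) + 2 * p (i + 1) + p i = k + 1) (hsum : t 0 + t 1 + t 2 = 6)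
    (g : Fin 11 → (ℤ × Fin 3) ⊕ Fin 2) (hg : Function.Injective g)
    (hsmall : ∀ j a i, g j = Sum.inl (a, i) → |a| < t i)
    (hpole : ∀ c, ∃ j < 5, g j = Sum.inr c) (hzero : ∀ i, ∃ j < 5, g j = Sum.inl (0, i))
    (hcov : ∀ (a : ℤ) i, |a| < t i → ∃ j, g j = Sum.inl (a, i))
    (hT : ∀ s ∈ ({{0, 5, 6}, {1, 7, 8}, {2, 9, 10}} : Finset (Finset (Fin 11))),
      s.image (intPoint k ∘ g) ∈ fiveTriples k) :
    adm 3 (2 * (6 * k + 5) + δ) ≤ 36 * k * k + 54 * k + xs + (2 * k - 2) * xt := by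
  -- So two integers of absolute value below `t i` differ by at most `2 * k` and are equal once they
  -- are congruent.
  have htk : ∀ i, t i ≤ k + 1 := fun i => by
    have h2 := hrel (i + 2)
    rw [(by decide : ∀ i : Fin 3, i + 2 + 1 = i) i] at h2
    omega
  have hcard : Fintype.card (Points (2 * k + 1) 2) = 6 * k + 5 := by rw [card_points]; omega
  have hfinj : Function.Injective (intPoint k ∘ g) := by
    intro j j' h
    refine hg ?_
    rcases hj : g j with ⟨a, i⟩ | c <;> rcases hj' : g j' with ⟨a', i'⟩ | c' <;>
      simp only [Function.comp_apply, hj, hj', intPoint, Sum.map_inl, Sum.map_inr, Prod.map_apply,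
        id, Sum.inl.injEq, Sum.inr.injEq, Prod.mk.injEq, reduceCtorEq] at h ⊢
    · obtain ⟨h, rfl⟩ := h
      refine ⟨intCast_zmod_inj h ?_, rfl⟩
      have h1 := abs_lt.1 (hsmall _ _ _ hj)
      have h2 := abs_lt.1 (hsmall _ _ _ hj')
      have := htk i
      rw [abs_lt]
      omega
    · exact h
  let φ : (Σ i : Fin 3, Fin (2 * p i)) → Fin 3 → Points (2 * k + 1) 2 := fun q r =>
    pt ((trianglePos k t p q.1 q.2 r).1 : ZMod (2 * k + 1)) (trianglePos k t p q.1 q.2 r).2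
  have hφ : ∀ q q' r r', φ q r = φ q' r' → q = q' ∧ r = r' := by
    rintro ⟨i, w⟩ ⟨i', w'⟩ r r' h
    obtain ⟨h1, h2⟩ := pt_inj.1 h
    have hb := trianglePos_bounds ht hrel i w w.isLt r
    have hb' := trianglePos_bounds ht hrel i' w' w'.isLt r'
    have hp := ht (trianglePos k t p i w r).2
    have hp' := ht (trianglePos k t p i' w' r').2
    have h1' := congrArg ZMod.val h1
    dsimp only at h1' h2
    rw [ZMod.val_cast_of_lt (by omega), ZMod.val_cast_of_lt (by omega)] at h1'
    obtain ⟨rfl, hw, hr⟩ := trianglePos_inj ht hrel w.isLt w'.isLt (Prod.ext h1' h2)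
    obtain rfl := Fin.ext hw
    exact ⟨rfl, hr⟩
  have hfφ : ∀ j q r, intPoint k (g j) ≠ φ q r := by
    rintro j ⟨i, w⟩ r h
    rcases hj : g j with ⟨a, i'⟩ | c <;> rw [hj] at h
    · obtain ⟨h1, h2⟩ := pt_inj.1 h
      simp only [id] at h1 h2
      have hb := trianglePos_bounds ht hrel i w w.isLt r
      have hp := ht (trianglePos k t p i w r).2
      have h3 := abs_lt.1 (hsmall _ _ _ hj)
      rw [h2] at h3
      have := intCast_zmod_inj (b := ((trianglePos k t p i w r).1 : ℤ)) (by exact_mod_cast h1)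
        (by rw [abs_lt]; omega)
      omega
    · exact absurd h (by simp [intPoint, φ])
  let G : Option (Σ i : Fin 3, Fin (2 * p i)) → Gadget := fun q =>
    q.elim sunGadget fun _ => triangleGadget
  let f : ∀ q, Fin (G q).size → Points (2 * k + 1) 2 := fun q =>
    match q with
    | none => intPoint k ∘ g
    | some q => φ q
  have hdiag : ∀ x i, ∃ q, ∃ j j', (j, j') ∈ (G q).pairs ∧ f q j = pt x i ∧ f q j' = pt x i := by
    intro x i
    have hx := ZMod.val_lt x
    have hxc : ((x.val : ℕ) : ZMod (2 * k + 1)) = x := ZMod.natCast_zmod_val x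
    have sun : ∀ a : ℤ, |a| < t i → (a : ZMod (2 * k + 1)) = x →
        ∃ q, ∃ j j', (j, j') ∈ (G q).pairs ∧ f q j = pt x i ∧ f q j' = pt x i := by
      rintro a ha rfl
      obtain ⟨j, hj⟩ := hcov a i ha
      have : intPoint k (g j) = pt (a : ZMod (2 * k + 1)) i := by rw [hj]; rfl
      exact ⟨none, j, j, diag_mem_sunGadget j, this, this⟩
    by_cases h1 : t i ≤ x.val
    · by_cases h2 : x.val + t i ≤ 2 * k + 1
      · obtain ⟨i', w, hw, r, hr⟩ := exists_trianglePos hrel h1 h2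
        have : φ ⟨i', ⟨w, hw⟩⟩ r = pt x i := by
          simp only [φ, hr, hxc]
        exact ⟨some ⟨i', ⟨w, hw⟩⟩, r, r, diag_mem_triangleGadget r, this, this⟩
      -- Residues near the upper end are represented by their negative lifts, as the sun is centred
      -- at zero.
      · refine sun (x.val - (2 * k + 1 : ℕ)) (by rw [abs_lt]; omega) ?_
        rw [Int.cast_sub, Int.cast_natCast, Int.cast_natCast, hxc, ZMod.natCast_self, sub_zero]
    · exact sun x.val (by rw [abs_lt]; omega) (by rw [Int.cast_natCast, hxc])
  have hcore : ∀ u v : Points (2 * k + 1) 2, (∃ j < 5, intPoint k (g j) = u) →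
      (∃ j < 5, intPoint k (g j) = v) →
      ∃ q, ∃ j j', (j, j') ∈ (G q).pairs ∧ (f q j = u ∧ f q j' = v ∨ f q j = v ∧ f q j' = u) := by
    rintro u v ⟨j, hj, rfl⟩ ⟨j', hj', rfl⟩
    rcases lt_trichotomy j j' with h | rfl | h
    · exact ⟨none, j, j', core_mem_sunGadget j j' h hj', Or.inl ⟨rfl, rfl⟩⟩
    · exact ⟨none, j, j, diag_mem_sunGadget j, Or.inl ⟨rfl, rfl⟩⟩
    · exact ⟨none, j', j, core_mem_sunGadget j' j h hj, Or.inr ⟨rfl, rfl⟩⟩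
  have hcore0 : ∀ i, ∃ j < 5, intPoint k (g j) = pt 0 i := by
    intro i
    obtain ⟨j, hj, h⟩ := hzero i
    exact ⟨j, hj, by rw [h, intPoint, Sum.map_inl, Prod.map_apply, Int.cast_zero]; rfl⟩
  have hcoreP : ∀ c, ∃ j < 5, intPoint k (g j) = Sum.inr c := by
    intro c
    obtain ⟨j, hj, h⟩ := hpole c
    exact ⟨j, hj, by rw [h]; rfl⟩
  have hhex : ∀ (x : ZMod (2 * k + 1)) i, x ≠ 0 → ∃ b ∈ fiveTriples k, pt x i ∈ b ∧
      pt (twistedHalf i (x + x)) (i + 1) ∈ b := fun x i hx =>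
    ⟨_, hexTriple_mem_fiveTriples hx i, by simp [hexTriple], by simp [hexTriple]⟩
  have hzero' : ∀ i, twistedHalf (k := k) i (0 + 0) = 0 := fun i => by
    unfold twistedHalf
    rw [half_add_self]
    simp
  have hmain := adm_le_of_design hδ hcard (fiveTriples k) card_of_mem_fiveTriples G f
    (by
      rintro (_ | q) j j' h
      · exact hfinj h
      · exact (hφ _ _ _ _ h).2)
    (by
      rintro (_ | q) (_ | q') j j' h
      · rfl
      · exact absurd h (hfφ _ _ _)
      · exact absurd h.symm (hfφ _ _ _)
      · exact congrArg some (hφ _ _ _ _ h).1)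
    (by
      rintro (_ | q) s hs'
      · exact hT s hs'
      · obtain rfl := mem_singleton.1 hs'
        exact image_trianglePos_mem ht hrel q.1 q.2.isLt)
    (fun q => q.elim xs fun _ => xt)
    (by
      rintro (_ | q)
      · exact hs
      · exact htri)
    (by
      rintro (⟨x, i⟩ | c) (⟨y, j⟩ | d)
      · by_cases h : (x, i) = (y, j)
        · rw [← h]
          obtain ⟨q, j, j', h1, h2, h3⟩ := hdiag x i
          exact Or.inr ⟨q, j, j', h1, Or.inl ⟨h2, h3⟩⟩
        · rcases latinTriples_cover (r := 2) twistedHalf_surjective h with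
            ⟨b, hb, h'⟩ | ⟨rfl, rfl⟩ | ⟨rfl, rfl⟩
          · exact Or.inl ⟨fun h' => h (Sum.inl_injective h'), b, latin_mem_fiveTriples hb, h'⟩
          · by_cases hx : x = 0
            · subst hx
              rw [hzero']
              exact Or.inr (hcore _ _ (hcore0 _) (hcore0 _))
            · exact Or.inl ⟨fun h' => h (Sum.inl_injective h'), hhex x i hx⟩
          · by_cases hy : y = 0
            · subst hy
              rw [hzero']
              exact Or.inr (hcore _ _ (hcore0 _) (hcore0 _))
            · obtain ⟨b, hb, h1, h2⟩ := hhex y j hy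
              exact Or.inl ⟨fun h' => h (Sum.inl_injective h'), b, hb, h2, h1⟩
      · by_cases hx : x = 0
        · subst hx
          exact Or.inr (hcore _ _ (hcore0 _) (hcoreP _))
        · exact Or.inl ⟨by simp, fiveTriples_cover_pole hx i d⟩
      · by_cases hy : y = 0
        · subst hy
          exact Or.inr (hcore _ _ (hcoreP _) (hcore0 _))
        · obtain ⟨b, hb, h1, h2⟩ := fiveTriples_cover_pole hy j c
          exact Or.inl ⟨by simp, b, hb, h2, h1⟩
      · exact Or.inr (hcore _ _ (hcoreP _) (hcoreP _)))
  refine hmain.trans ?_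
  -- Adding the three relations gives `p 0 + p 1 + p 2 = k - 1`.
  have hK : Fintype.card (Σ i : Fin 3, Fin (2 * p i)) = 2 * k - 2 := by
    rw [Fintype.card_sigma]
    simp only [Fintype.card_fin, Fin.sum_univ_three]
    have h0 : t 1 + 2 * p 1 + p 0 = k + 1 := hrel 0
    have h1 : t 2 + 2 * p 2 + p 1 = k + 1 := hrel 1
    have h2 : t 0 + 2 * p 0 + p 2 = k + 1 := hrel 2
    omega
  rw [Fintype.sum_option]
  simp only [Option.elim, sum_const, card_univ, hK, smul_eq_mul]
  have h1 := fiveTriples_card_le (k := k)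
  have h2 := choose_two_mul (2 * k + 1)
  nlinarith

/-- Supplies the triples of the sun at the poles: `x = 1` for the first pole and `x = -1` for the
second. -/
lemma hexTriple_mem_of_unit {k : ℕ} (hk : 1 ≤ k) {x : ℤ} (hx : x = 1 ∨ x = -1) {i : Fin 3}
    (hi : i ≠ 1) :
    ({Sum.inr (if x = 1 then 0 else 1), pt (x : ZMod (2 * k + 1)) i,
      pt (((if i = 2 then -x else x : ℤ)) : ZMod (2 * k + 1)) (i + 1)} :
      Finset (Points (2 * k + 1) 2)) ∈ fiveTriples k := by
  have : Fact (1 < 2 * k + 1) := ⟨by omega⟩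
  have hx0 : (x : ZMod (2 * k + 1)) ≠ 0 := by
    rcases hx with rfl | rfl <;> simp
  have hpole : hexPole (x : ZMod (2 * k + 1)) i = if x = 1 then 0 else 1 := by
    rcases hx with rfl | rfl
    · rw [if_pos rfl, Int.cast_one, hexPole, ZMod.val_one, if_pos (iff_of_true hk hi)]
    · rw [if_neg (by decide), Int.cast_neg, Int.cast_one, hexPole]
      have h1 := val_neg_le_iff (k := k) (x := 1) one_ne_zero
      rw [ZMod.val_one] at h1
      rw [if_neg]
      intro h
      exact h1.1 (h.2 hi) hk
  have hhalf : twistedHalf i ((x : ZMod (2 * k + 1)) + (x : ZMod (2 * k + 1))) =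
      (((if i = 2 then -x else x : ℤ)) : ZMod (2 * k + 1)) := by
    unfold twistedHalf
    rw [half_add_self]
    split_ifs <;> simp
  have hmem := hexTriple_mem_fiveTriples hx0 i
  rw [hexTriple, hpole, hhalf] at hmem
  convert hmem using 1
  ext q
  simp only [mem_insert, mem_singleton]
  tauto

/-- Supplies the third triple of the sun, at one of the zeros of the hole: `y` and `-y` have sum
zero, and half of zero is zero. -/
lemma zeroTriple_mem {k : ℕ} {y : ℤ} (hy : 0 < y) (hyk : y ≤ k) (i : Fin 3) :
    ({pt ((0 : ℤ) : ZMod (2 * k + 1)) (i + 1), pt (y : ZMod (2 * k + 1)) i,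
      pt ((-y : ℤ) : ZMod (2 * k + 1)) i} : Finset (Points (2 * k + 1) 2)) ∈ fiveTriples k := by
  have hne : (y : ZMod (2 * k + 1)) ≠ ((-y : ℤ) : ZMod (2 * k + 1)) := by
    intro h
    have := intCast_zmod_inj h (by rw [abs_lt]; omega)
    omega
  have h := triple_mem_latinTriples (r := 2) (τ := twistedHalf) hne i
  have h0 : twistedHalf i ((y : ZMod (2 * k + 1)) + ((-y : ℤ) : ZMod (2 * k + 1))) =
      ((0 : ℤ) : ZMod (2 * k + 1)) := by
    rw [← Int.cast_add, add_neg_cancel, Int.cast_zero, twistedHalf, half, zero_mul, neg_zero,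
      ite_self]
  rw [h0] at h
  exact latin_mem_fiveTriples h

/-! ### Choice of the sun according to k mod 3 -/

/-- A finite check of the hypotheses on the points of the sun. -/
def SunCheck (t : Fin 3 → ℕ) (g : Fin 11 → (ℤ × Fin 3) ⊕ Fin 2) : Prop :=
  (∀ j j', g j = g j' → j = j') ∧
  (∀ j, Sum.elim (fun q : ℤ × Fin 3 => decide (|q.1| < t q.2)) (fun _ => true) (g j) = true) ∧
  (∀ c, ∃ j < 5, g j = Sum.inr c) ∧ (∀ i, ∃ j < 5, g j = Sum.inl (0, i)) ∧
  (∀ i, t i ≤ 3) ∧ ∀ a ∈ Icc (-2 : ℤ) 2, ∀ i, |a| < t i → ∃ j, g j = Sum.inl (a, i)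

theorem adm_le_of_sunCheck {δ : ℕ} (hδ : δ ≤ 1) {xs xt : ℕ} (hs : sunGadget.Extra δ xs)
    (htri : triangleGadget.Extra δ xt) {k : ℕ} {t p : Fin 3 → ℕ} (ht : ∀ i, 1 ≤ t i)
    (hrel : ∀ i, t (i + 1) + 2 * p (i + 1) + p i = k + 1) (hsum : t 0 + t 1 + t 2 = 6)
    (g : Fin 11 → (ℤ × Fin 3) ⊕ Fin 2) (hg : SunCheck t g)
    (hT : ∀ s ∈ ({{0, 5, 6}, {1, 7, 8}, {2, 9, 10}} : Finset (Finset (Fin 11))),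
      s.image (intPoint k ∘ g) ∈ fiveTriples k) :
    adm 3 (2 * (6 * k + 5) + δ) ≤ 36 * k * k + 54 * k + xs + (2 * k - 2) * xt := by
  obtain ⟨h1, h2, h3, h4, h5, h6⟩ := hg
  refine adm_le_of_sun hδ hs htri ht hrel hsum g (fun j j' => h1 j j') (fun j a i hj => ?_) h3 h4
    (fun a i ha => h6 a ?_ i ha) hT
  · have := h2 j
    rw [hj] at this
    exact of_decide_eq_true this
  · have := abs_lt.1 ha
    have := h5 i
    rw [mem_Icc]
    omega

/-- The relations between `t` and `p` have to be solved in integers with the `t i` summing to six;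
the residue of `k` modulo 3 decides the shape of `t`. In each case the sun consists of one hexagon
edge at `1`, one at `-1` and a pair `y`, `-y`. -/
theorem adm_le_five_mod_six {δ : ℕ} (hδ : δ ≤ 1) {xs xt : ℕ} (hs : sunGadget.Extra δ xs)
    (htri : triangleGadget.Extra δ xt) {k : ℕ} (hk : 1 ≤ k) :
    adm 3 (2 * (6 * k + 5) + δ) ≤ 36 * k * k + 54 * k + xs + (2 * k - 2) * xt := by
  obtain ⟨q, hq | hq | hq⟩ : ∃ q, k = 3 * q ∨ k = 3 * q + 1 ∨ k = 3 * q + 2 :=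
    ⟨k / 3, by omega⟩
  · refine adm_le_of_sunCheck hδ hs htri (t := ![2, 1, 3]) (p := ![q, q, q - 1]) (by decide)
      (fun i => ?_) rfl ![.inr 0, .inr 1, .inl (0, 0), .inl (0, 1), .inl (0, 2), .inl (1, 2),
        .inl (-1, 0), .inl (-1, 2), .inl (1, 0), .inl (2, 2), .inl (-2, 2)] (by unfold SunCheck; decide +kernel)
      fun s hs' => ?_
    · fin_cases i
      · change 1 + 2 * q + q = k + 1
        omega
      · change 3 + 2 * (q - 1) + q = k + 1
        omega
      · change 2 + 2 * q + (q - 1) = k + 1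
        omega
    · simp only [mem_insert, mem_singleton] at hs'
      rcases hs' with rfl | rfl | rfl <;> rw [image_insert, image_insert, image_singleton]
      · exact hexTriple_mem_of_unit hk (x := 1) (Or.inl rfl) (i := 2) (by decide)
      · exact hexTriple_mem_of_unit hk (x := -1) (Or.inr rfl) (i := 2) (by decide)
      · exact zeroTriple_mem (y := 2) (by decide) (by omega) 2
  · refine adm_le_of_sunCheck hδ hs htri (t := ![2, 2, 2]) (p := ![q, q, q]) (by decide)
      (fun i => ?_) rfl ![.inr 0, .inr 1, .inl (0, 0), .inl (0, 1), .inl (0, 2), .inl (1, 0),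
        .inl (1, 1), .inl (-1, 0), .inl (-1, 1), .inl (1, 2), .inl (-1, 2)] (by unfold SunCheck; decide +kernel)
      fun s hs' => ?_
    · fin_cases i <;>
      · change 2 + 2 * q + q = k + 1
        omega
    · simp only [mem_insert, mem_singleton] at hs'
      rcases hs' with rfl | rfl | rfl <;> rw [image_insert, image_insert, image_singleton]
      · exact hexTriple_mem_of_unit hk (x := 1) (Or.inl rfl) (i := 0) (by decide)
      · exact hexTriple_mem_of_unit hk (x := -1) (Or.inr rfl) (i := 0) (by decide)
      · exact zeroTriple_mem (y := 1) (by decide) (by omega) 2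
  · refine adm_le_of_sunCheck hδ hs htri (t := ![2, 3, 1]) (p := ![q, q, q + 1]) (by decide)
      (fun i => ?_) rfl ![.inr 0, .inr 1, .inl (0, 2), .inl (0, 0), .inl (0, 1), .inl (1, 0),
        .inl (1, 1), .inl (-1, 0), .inl (-1, 1), .inl (2, 1), .inl (-2, 1)] (by unfold SunCheck; decide +kernel)
      fun s hs' => ?_
    · fin_cases i
      · change 3 + 2 * q + q = k + 1
        omega
      · change 1 + 2 * (q + 1) + q = k + 1
        omega
      · change 2 + 2 * q + (q + 1) = k + 1
        omega
    · simp only [mem_insert, mem_singleton] at hs'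
      rcases hs' with rfl | rfl | rfl <;> rw [image_insert, image_insert, image_singleton]
      · exact hexTriple_mem_of_unit hk (x := 1) (Or.inl rfl) (i := 0) (by decide)
      · exact hexTriple_mem_of_unit hk (x := -1) (Or.inr rfl) (i := 0) (by decide)
      · exact zeroTriple_mem (y := 2) (by decide) (by omega) 1

/-- For n = 5 the hole is the whole point set, and there is no triple to attach a sun to. -/
lemma adm_le_of_fiveGadget {δ : ℕ} (hδ : δ ≤ 1) {x : ℕ} (hx : fiveGadget.Extra δ x) :
    adm 3 (2 * 5 + δ) ≤ x := by
  have h := adm_le_of_design (P := Fin 5) hδ (Fintype.card_fin 5) ∅ (by simp) (K := Unit)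
    (fun _ => fiveGadget) (fun _ => (id : Fin 5 → Fin 5)) (fun _ i j h => h)
    (fun _ _ _ _ _ => rfl) (fun _ t ht => absurd ht (notMem_empty t)) (fun _ => x) (fun _ => hx)
    (fun i j => Or.inr ⟨(), ?_⟩)
  · simpa using h
  · have : ∀ i j : Fin 5, (i, j) ∈ fiveGadget.pairs ∨ (j, i) ∈ fiveGadget.pairs := by
      change ∀ i j : Fin 5, (i, j) ∈ ({(0, 1), (0, 2), (0, 3), (0, 4), (1, 2), (1, 3), (1, 4),
        (2, 3), (2, 4), (3, 4), (0, 0), (1, 1), (2, 2), (3, 3), (4, 4)} : Finset (Fin 5 × Fin 5)) ∨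
        (j, i) ∈ ({(0, 1), (0, 2), (0, 3), (0, 4), (1, 2), (1, 3), (1, 4), (2, 3), (2, 4), (3, 4),
        (0, 0), (1, 1), (2, 2), (3, 3), (4, 4)} : Finset (Fin 5 × Fin 5))
      decide
    rcases this i j with h | h
    · exact ⟨i, j, h, Or.inl ⟨rfl, rfl⟩⟩
    · exact ⟨j, i, h, Or.inr ⟨rfl, rfl⟩⟩

end RingGrooming

/-! ### The residue classes and the numerical bounds -/

theorem mainTheorem12 (N : ℕ) :
    (N ≡ 2 [MOD 12] →
      (RingGrooming.adm 3 N : ℚ) ≤ (N : ℚ) ^ 2 / 4 + ((N : ℚ) + 4) / 6) ∧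
    (N ≡ 3 [MOD 12] →
      (RingGrooming.adm 3 N : ℚ) ≤ ((N : ℚ) ^ 2 + 3) / 4) ∧
    (N ≡ 6 [MOD 12] →
      (RingGrooming.adm 3 N : ℚ) ≤ (N : ℚ) ^ 2 / 4 + (N : ℚ) / 6) ∧
    (N ≡ 7 [MOD 12] →
      (RingGrooming.adm 3 N : ℚ) ≤ ((N : ℚ) ^ 2 - 1) / 4) ∧
    (N ≡ 10 [MOD 12] →
      (RingGrooming.adm 3 N : ℚ) ≤ (N : ℚ) ^ 2 / 4 + ((N : ℚ) + 8) / 6) ∧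
    (N ≡ 11 [MOD 12] →
      (RingGrooming.adm 3 N : ℚ) ≤
        ((N : ℚ) ^ 2 - 1) / 4 + (if N = 11 ∨ N = 35 then 1 else 0)) ∧
    (N ≡ 0 [MOD 2] →
      (N : ℚ) ^ 2 / 4 ≤ (RingGrooming.adm 3 N : ℚ)) ∧
    (N ≡ 3 [MOD 4] →
      (3 * (N : ℚ) ^ 2 - (N : ℚ)) / 12 ≤ (RingGrooming.adm 3 N : ℚ)) := by
  have split : ∀ r < 12, N ≡ r [MOD 12] → ∃ k, N = 12 * k + r := fun r hr h =>
    ⟨N / 12, by unfold Nat.ModEq at h; omega⟩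
  refine ⟨fun h => ?_, fun h => ?_, fun h => ?_, fun h => ?_, fun h => ?_, fun h => ?_,
    fun h => ?_, fun h => ?_⟩
  · obtain ⟨k, rfl⟩ := split 2 (by norm_num) h
    have h := RingGrooming.adm_le_one_mod_six (δ := 0) (by norm_num)
      RingGrooming.pointGadget_extra_even RingGrooming.triangleGadget_extra_even
      RingGrooming.cycleGadget_extra_even k
    rw [show 2 * (6 * k + 1) + 0 = 12 * k + 2 by ring] at h
    have h' : (RingGrooming.adm 3 (12 * k + 2) : ℚ) ≤ _ := Nat.cast_le.2 h
    refine h'.trans (le_of_eq ?_)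
    push_cast
    ring
  · obtain ⟨k, rfl⟩ := split 3 (by norm_num) h
    have h := RingGrooming.adm_le_one_mod_six (δ := 1) (by norm_num)
      RingGrooming.pointGadget_extra_odd RingGrooming.triangleGadget_extra_odd
      RingGrooming.cycleGadget_extra_odd k
    rw [show 2 * (6 * k + 1) + 1 = 12 * k + 3 by ring] at h
    have h' : (RingGrooming.adm 3 (12 * k + 3) : ℚ) ≤ _ := Nat.cast_le.2 h
    refine h'.trans (le_of_eq ?_)
    push_cast
    ring
  · obtain ⟨k, rfl⟩ := split 6 (by norm_num) h
    have h := RingGrooming.adm_le_three_mod_six (δ := 0) (by norm_num)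
      RingGrooming.triangleGadget_extra_even k
    rw [show 2 * (6 * k + 3) + 0 = 12 * k + 6 by ring] at h
    have h' : (RingGrooming.adm 3 (12 * k + 6) : ℚ) ≤ _ := Nat.cast_le.2 h
    refine h'.trans (le_of_eq ?_)
    push_cast
    ring
  · obtain ⟨k, rfl⟩ := split 7 (by norm_num) h
    have h := RingGrooming.adm_le_three_mod_six (δ := 1) (by norm_num)
      RingGrooming.triangleGadget_extra_odd k
    rw [show 2 * (6 * k + 3) + 1 = 12 * k + 7 by ring] at h
    have h' : (RingGrooming.adm 3 (12 * k + 7) : ℚ) ≤ _ := Nat.cast_le.2 h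
    refine h'.trans (le_of_eq ?_)
    push_cast
    ring
  · obtain ⟨k, rfl⟩ := split 10 (by norm_num) h
    rcases k with _ | k
    · have h := RingGrooming.adm_le_of_fiveGadget (δ := 0) (by norm_num)
        RingGrooming.fiveGadget_extra_even
      have h' : (RingGrooming.adm 3 (12 * 0 + 10) : ℚ) ≤ (28 : ℕ) := Nat.cast_le.2 h
      refine h'.trans (le_of_eq ?_)
      norm_num
    · have h := RingGrooming.adm_le_five_mod_six (δ := 0) (by norm_num)
        RingGrooming.sunGadget_extra_even RingGrooming.triangleGadget_extra_even
        (Nat.le_add_left 1 k)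
      rw [show 2 * (6 * (k + 1) + 5) + 0 = 12 * (k + 1) + 10 by ring,
        show 2 * (k + 1) - 2 = 2 * k by omega] at h
      have h' : (RingGrooming.adm 3 (12 * (k + 1) + 10) : ℚ) ≤ _ := Nat.cast_le.2 h
      refine h'.trans (le_of_eq ?_)
      push_cast
      ring
  · obtain ⟨k, rfl⟩ := split 11 (by norm_num) h
    rcases k with _ | k
    -- N = 11 is the only case in which the summand ε is used: 31 exceeds (N² - 1) / 4 = 30 by one.
    · have h := RingGrooming.adm_le_of_fiveGadget (δ := 1) (by norm_num)
        RingGrooming.fiveGadget_extra_odd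
      have h' : (RingGrooming.adm 3 (12 * 0 + 11) : ℚ) ≤ (31 : ℕ) := Nat.cast_le.2 h
      refine h'.trans (le_of_eq ?_)
      norm_num
    · have h := RingGrooming.adm_le_five_mod_six (δ := 1) (by norm_num)
        RingGrooming.sunGadget_extra_odd RingGrooming.triangleGadget_extra_odd
        (Nat.le_add_left 1 k)
      rw [show 2 * (6 * (k + 1) + 5) + 1 = 12 * (k + 1) + 11 by ring,
        show 2 * (k + 1) - 2 = 2 * k by omega] at h
      have h' : (RingGrooming.adm 3 (12 * (k + 1) + 11) : ℚ) ≤ _ := Nat.cast_le.2 h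
      -- The sun attains (N² - 1) / 4 for every larger N, including N = 35, so ε is only discarded
      -- as nonnegative.
      refine h'.trans (le_trans (le_of_eq ?_) (le_add_of_nonneg_right (by split_ifs <;> norm_num)))
      push_cast
      ring
  · have h' : ((N * N : ℕ) : ℚ) ≤ (4 * RingGrooming.adm 3 N : ℕ) :=
      Nat.cast_le.2 (RingGrooming.even_lower h)
    push_cast at h'
    linarith [sq (N : ℚ)]
  · have h' : ((N * (3 * N - 1) : ℕ) : ℚ) ≤ (12 * RingGrooming.adm 3 N : ℕ) :=
      Nat.cast_le.2 (RingGrooming.odd_lower h)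
    have hN : 1 ≤ 3 * N := by
      unfold Nat.ModEq at h
      omega
    rw [Nat.cast_mul, Nat.cast_sub hN] at h'
    push_cast at h'
    linarith [sq (N : ℚ)]
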